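/- **Setting.** All graphs are finite and undirected; multiple edges are allowed. A graph $\Gamma$ is *2-edge-connected* if it is connected and stays connected after the removal of any one edge. A *cycle* is the edge set of a closed walk with no repeated vertices or edges. A bijection $F:E(\Gamma_1)\to E(\Gamma_2)$ is *cycle-preserving* if a set of edges $C\subseteq E(\Gamma_1)$ is a cycle if and only if $F(C)$ is a cycle. Let $\mathbb Z[q,q^{-1}]$ carry the involution $\overline{f}(q)=f(q^{-1})$. A *$q$-lattice* is a finitely generated free $\mathbb Z[q,q^{-1}]$-module $L$ with a non-degenerate form $\langle\cdot,\cdot\rangle:L\times L\to\mathbb Z[q,q^{-1}]$ that is linear in the second and $q$-antilinear in the first argument, and with a $q$-antilinear involution $d$ such that $\langle x,y\rangle=\langle d(y),d(x)\rangle$ and $d$ becomes the identity at $q=1$. Two $q$-lattices are *isomorphic* ($\cong$) if there is a $\mathbb Z[q,q^{-1}]$-linear isomorphism between them that preserves the forms; in terms of Gram matrices, $A'=U^*AU$ with $U$ invertible over $\mathbb Z[q,q^{-1}]$, where $U^*$ is the transpose of $U$ with $q\mapsto q^{-1}$ applied to all entries. Let $\Gamma$ be a 2-edge-connected loopless graph,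 $T\subseteq E(\Gamma)$ a spanning tree, and fix an arbitrary orientation of the edges. For $j\in E(\Gamma)\setminus T$ let $C_j$ be the fundamental cycle of $j$, that is, the unique cycle in $T\cup\{j\}$, directed so that it runs along $j$ in the direction of the orientation. For $i\in T$ and $j\notin T$ put $\epsilon_{ij}=1$ or $-1$ if $C_j$ runs through $i$ along, respectively against, the orientation of $i$, and $\epsilon_{ij}=0$ if $i$ is not in $C_j$. Write $C_j=j+\sum_{i\in T}\epsilon_{ij}\,i\in\mathbb Z^{E(\Gamma)}$, where $\mathbb Z^{E(\Gamma)}$ has the standard Euclidean pairing. Let $K_0$ be the free $\mathbb Z[q,q^{-1}]$-module with basis $\{[P_e]:e\in E(\Gamma)\}$ and the sesquilinear form with Gram matrix $$G=\begin{pmatrix} I & qM\\ qM^{t} & G_{\mathcal F}\end{pmatrix},\qquad M=(\epsilon_{ij})_{i\in T,\,j\notin T},\qquad (G_{\mathcal F})_{ij}=\begin{cases}1+(\langle C_i,C_i\rangle-1)q^2 & i=j,\\ \langle C_i,C_j\rangle q^2& i\ne j,\end{cases}$$ the rows and columns being indexed first by $T$ and then by $E(\Gamma)\setminus T$. (This is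 the Grothendieck group of graded modules over the bipartite algebra of $(\Gamma,T)$ with its graded Euler form, in the basis of indecomposable projective modules; edge signs are taken into account.) Let $[L_e]\in K_0$ be the element whose coordinates in the basis $\{[P_e]\}$ form the column $e$ of $G^{-1}$ (the class of the simple module), so that $\langle [P_e],[L_f]\rangle=\delta_{ef}$. * The *$q$-flow lattice* $\mathcal F_q(\Gamma,T)$ is the $\mathbb Z[q,q^{-1}]$-submodule of $K_0$ generated by $\{[P_j]:j\notin T\}$, with the inherited form and the $q$-antilinear involution $d$ that fixes all $[P_j]$, $j\notin T$. * The *$q$-cut lattice* $\mathcal C_q(\Gamma,T)$ is the $\mathbb Z[q,q^{-1}]$-submodule of $K_0$ generated by $\{[L_i]:i\in T\}$, with the inherited form and the $q$-antilinear involution $d$ that fixes all $[L_i]$, $i\in T$. **Theorem.** Let $\Gamma_1,\Gamma_2$ be 2-edge-connected loopless graphs with orientations and with spanning trees $T_1,T_2$. The following are equivalent: 1. $\mathcal F_q(\Gamma_1,T_1)\cong\mathcal F_q(\Gamma_2,T_2)$; 2. there is a cycle-preserving bijection $F:E(\Gamma_1)\to E(\Gamma_2)$ with $F(T_1)=T_2$;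 3. $\mathcal C_q(\Gamma_1,T_1)\cong\mathcal C_q(\Gamma_2,T_2)$. The same equivalence holds if the isomorphisms in (1) and (3) are required, in addition, to commute with the involutions $d$. -/

import Mathlib

/-! ## `q`-lattices -/

/-- The ring `ℤ[q, q⁻¹]`; the variable `q` is `LaurentPolynomial.T 1`. -/
abbrev ZQ : Type := LaurentPolynomial ℤ

/-- The bar involution `q ↦ q⁻¹` of `ℤ[q, q⁻¹]`. -/
noncomputable def qbar : ZQ →+* ZQ :=
  (LaurentPolynomial.invert (R := ℤ)).toAlgHom.toRingHom

theorem qbar_C_mul_T (a n : ℤ) :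
    qbar (LaurentPolynomial.C a * LaurentPolynomial.T n) =
      LaurentPolynomial.C a * LaurentPolynomial.T (-n) := by
  simp [qbar]

theorem qbar_qbar (f : ZQ) : qbar (qbar f) = f :=
  LaurentPolynomial.involutive_invert f

/-- A `q`-lattice: a finitely generated free `ℤ[q, q⁻¹]`-module with a non-degenerate form that is
`q`-antilinear in the first and linear in the second argument, and a `q`-antilinear involution `d`
with `⟨x, y⟩ = ⟨d y, d x⟩` that becomes the identity after setting `q = 1`, i.e. on the quotient
of the module by its submodule of multiples of `q - 1`. -/
structure QLattice where
  carrier : Type*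
  [addCommGroup : AddCommGroup carrier]
  [module : Module ZQ carrier]
  [free : Module.Free ZQ carrier]
  [finite : Module.Finite ZQ carrier]
  form : carrier →ₛₗ[qbar] carrier →ₗ[ZQ] ZQ
  nondegenerate : form.Nondegenerate
  d : carrier →ₛₗ[qbar] carrier
  d_d : ∀ x, d (d x) = x
  form_d : ∀ x y, form x y = form (d y) (d x)
  d_at_one : ∀ x, d x - x ∈
    Ideal.span {(LaurentPolynomial.T 1 - 1 : ZQ)} • (⊤ : Submodule ZQ carrier)

attribute [instance] QLattice.addCommGroup QLattice.module QLattice.free QLattice.finite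

/-- Isomorphism of `q`-lattices: a module isomorphism that preserves the forms. In terms of Gram
matrices, `A' = T* A T` with `T` invertible over `ℤ[q, q⁻¹]`. -/
def QLattice.Isomorphic (L L' : QLattice) : Prop :=
  ∃ φ : L.carrier ≃ₗ[ZQ] L'.carrier, ∀ x y, L'.form (φ x) (φ y) = L.form x y

/-- Isomorphism of `q`-lattices that moreover intertwines the involutions. -/
def QLattice.StronglyIsomorphic (L L' : QLattice) : Prop :=
  ∃ φ : L.carrier ≃ₗ[ZQ] L'.carrier,
    (∀ x y, L'.form (φ x) (φ y) = L.form x y) ∧ ∀ x, φ (L.d x) = L'.d (φ x)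

section OfBasis

variable {ι M : Type*} [Fintype ι] [AddCommGroup M] [Module ZQ M]

/-- The `q`-antilinear map that fixes the members of a basis. -/
noncomputable def antilinearFixing (b : Module.Basis ι ZQ M) : M →ₛₗ[qbar] M where
  toFun x := ∑ i, qbar (b.repr x i) • b i
  map_add' x y := by simp [add_smul, Finset.sum_add_distrib]
  map_smul' c x := by simp [mul_smul, Finset.smul_sum]

theorem antilinearFixing_basis (b : Module.Basis ι ZQ M) (i : ι) :
    antilinearFixing b (b i) = b i := by
  classical
  simp [antilinearFixing, Finsupp.single_apply, apply_ite, ite_smul]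

theorem repr_antilinearFixing (b : Module.Basis ι ZQ M) (x : M) (i : ι) :
    b.repr (antilinearFixing b x) i = qbar (b.repr x i) := by
  classical
  simp [antilinearFixing, Finsupp.single_apply]

theorem form_eq_sum (b : Module.Basis ι ZQ M) (F : M →ₛₗ[qbar] M →ₗ[ZQ] ZQ) (x y : M) :
    F x y = ∑ i, ∑ j, qbar (b.repr x i) * b.repr y j * F (b i) (b j) := by
  conv_lhs => rw [← b.sum_repr x, ← b.sum_repr y]
  simp only [map_sum, LinearMap.sum_apply, LinearMap.map_smulₛₗ, LinearMap.smul_apply,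
    smul_eq_mul, map_smul, Finset.mul_sum]
  rw [Finset.sum_comm]
  refine Finset.sum_congr rfl fun i _ => Finset.sum_congr rfl fun j _ => ?_
  ring

theorem qbar_sub_mem (f : ZQ) :
    qbar f - f ∈ Ideal.span {(LaurentPolynomial.T 1 - 1 : ZQ)} := by
  have hT : ∀ n : ℕ, (LaurentPolynomial.T (n : ℤ) - 1 : ZQ) ∈
      Ideal.span {(LaurentPolynomial.T 1 - 1 : ZQ)} := by
    intro n
    rw [Ideal.mem_span_singleton]
    have h : (LaurentPolynomial.T (n : ℤ) : ZQ) = LaurentPolynomial.T 1 ^ n := by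
      rw [LaurentPolynomial.T_pow, mul_one]
    rw [h]
    exact sub_one_dvd_pow_sub_one _ n
  have hT' : ∀ n : ℤ, (LaurentPolynomial.T n - 1 : ZQ) ∈
      Ideal.span {(LaurentPolynomial.T 1 - 1 : ZQ)} := by
    intro n
    obtain ⟨m, rfl | rfl⟩ := n.eq_nat_or_neg
    · exact hT m
    · have h : (LaurentPolynomial.T (-(m : ℤ)) - 1 : ZQ) =
          -LaurentPolynomial.T (-(m : ℤ)) * (LaurentPolynomial.T (m : ℤ) - 1) := by
        rw [mul_sub, neg_mul, ← LaurentPolynomial.T_add]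
        simp [sub_eq_add_neg, add_comm]
      rw [h]
      exact Ideal.mul_mem_left _ _ (hT m)
  induction f using LaurentPolynomial.induction_on' with
  | add f g hf hg =>
    have h : qbar (f + g) - (f + g) = (qbar f - f) + (qbar g - g) := by
      rw [map_add]; ring
    rw [h]
    exact add_mem hf hg
  | C_mul_T n a =>
    have h : qbar (LaurentPolynomial.C a * LaurentPolynomial.T n) -
        LaurentPolynomial.C a * LaurentPolynomial.T n =
        LaurentPolynomial.C a *
          ((LaurentPolynomial.T (-n) - 1) - (LaurentPolynomial.T n - 1)) := by
      rw [qbar_C_mul_T]; ring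
    rw [h]
    exact Ideal.mul_mem_left _ _ (sub_mem (hT' _) (hT' _))

/-- The `q`-lattice with symmetric invertible (over the fraction field) Gram matrix in the basis
`b`, and with the involution `d` that fixes the members of `b`. -/
noncomputable def QLattice.ofBasis [DecidableEq ι] (b : Module.Basis ι ZQ M)
    (F : M →ₛₗ[qbar] M →ₗ[ZQ] ZQ)
    (hsymm : ∀ i j, F (b i) (b j) = F (b j) (b i))
    (hdet : (Matrix.of fun i j => F (b i) (b j)).det ≠ 0) : QLattice where
  carrier := M
  free := Module.Free.of_basis b
  finite := Module.Finite.of_basis b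
  form := F
  nondegenerate := by
    constructor
    · intro x hx
      have h : Matrix.vecMul (fun i => qbar (b.repr x i))
          (Matrix.of fun i j => F (b i) (b j)) = 0 := by
        funext j
        have := hx (b j)
        rw [form_eq_sum b] at this
        simpa [Matrix.vecMul, dotProduct, Finsupp.single_apply] using this
      have h0 := Matrix.eq_zero_of_vecMul_eq_zero hdet h
      apply b.ext_elem
      intro i
      have := congrArg qbar (congrFun h0 i)
      simpa [qbar_qbar] using this
    · intro y hy
      have h : Matrix.mulVec (Matrix.of fun i j => F (b i) (b j))
          (fun i => b.repr y i) = 0 := by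
        funext i
        have := hy (b i)
        rw [form_eq_sum b] at this
        simpa [Matrix.mulVec, dotProduct, Finsupp.single_apply, apply_ite, mul_comm] using this
      have h0 := Matrix.eq_zero_of_mulVec_eq_zero hdet h
      apply b.ext_elem
      intro i
      simpa using congrFun h0 i
  d := antilinearFixing b
  d_d x := by
    apply b.ext_elem
    intro i
    rw [repr_antilinearFixing, repr_antilinearFixing, qbar_qbar]
  form_d x y := by
    rw [form_eq_sum b F x y, form_eq_sum b F (antilinearFixing b y), Finset.sum_comm]
    refine Finset.sum_congr rfl fun i _ => Finset.sum_congr rfl fun j _ => ?_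
    rw [repr_antilinearFixing, repr_antilinearFixing, qbar_qbar, hsymm j i]
    ring
  d_at_one x := by
    have h : antilinearFixing b x - x = ∑ i, (qbar (b.repr x i) - b.repr x i) • b i := by
      conv_lhs => rw [← b.sum_repr (antilinearFixing b x)]
      nth_rewrite 2 [← b.sum_repr x]
      simp only [repr_antilinearFixing, sub_smul, Finset.sum_sub_distrib]
    rw [h]
    exact Submodule.sum_mem _ fun i _ =>
      Submodule.smul_mem_smul (qbar_sub_mem _) Submodule.mem_top

end OfBasis

/-! ## Signed bipartite graphs and their cut and flow lattices -/

/-- A (simple) signed bipartite graph with bipartition `E₀`, `E₁`: `sign i j` is `0` if `i` and `j`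
are not adjacent, and is the sign `1` or `-1` of the edge joining them otherwise. -/
structure SignedBipartiteGraph (E₀ E₁ : Type*) where
  sign : E₀ → E₁ → SignType

namespace SignedBipartiteGraph

set_option linter.unusedSectionVars false

variable {E₀ E₁ : Type*} [Fintype E₀] [Fintype E₁] [DecidableEq E₀] [DecidableEq E₁]
variable (B : SignedBipartiteGraph E₀ E₁)

/-- The signed adjacency matrix. -/
def adj : Matrix E₀ E₁ ℤ := Matrix.of fun i j => (B.sign i j : ℤ)

/-- The fundamental cycle `C_i = i + ∑ ε_{ij} j`, for `i ∈ E₁`, in the Euclidean lattice `ℤ^E`,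
`E = E₀ ∪ E₁`. -/
def fundCycle (i : E₁) : E₀ ⊕ E₁ → ℤ := Sum.elim (fun j => B.adj j i) (Pi.single i 1)

/-- The Gram matrix in the basis `([P_i])`, `i ∈ E₁`, of the `q`-flow lattice:
`1 + (⟨C_i, C_i⟩ - 1) q²` on the diagonal and `⟨C_i, C_j⟩ q²` off the diagonal. -/
noncomputable def gramFlow : Matrix E₁ E₁ ZQ := Matrix.of fun i j =>
  if i = j then
    1 + LaurentPolynomial.C (dotProduct (B.fundCycle i) (B.fundCycle i) - 1) * LaurentPolynomial.T 2
  else LaurentPolynomial.C (dotProduct (B.fundCycle i) (B.fundCycle j)) * LaurentPolynomial.T 2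

/-- The matrix `q M_B`. -/
noncomputable def qAdj : Matrix E₀ E₁ ZQ :=
  Matrix.of fun i j => LaurentPolynomial.C (B.adj i j) * LaurentPolynomial.T 1

/-- The Gram matrix of the graded Euler form (at `t = -1`) on the Grothendieck group `K₀` of graded
modules over the bipartite algebra of `B`, in the basis `([P_i])`, `i ∈ E₀ ∪ E₁`, of classes of
indecomposable projectives. The entry at `(i, j)` is the signed graded dimension of
`Hom(P_i, P_j)`, which is spanned by the paths from `i` to `j` in the bipartite algebra. -/
noncomputable def gramP : Matrix (E₀ ⊕ E₁) (E₀ ⊕ E₁) ZQ :=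
  Matrix.fromBlocks 1 B.qAdj B.qAdj.transpose B.gramFlow

theorem gramFlow_eq : B.gramFlow = 1 + B.qAdj.transpose * B.qAdj := by
  have hT : (LaurentPolynomial.T 2 : ZQ) = LaurentPolynomial.T 1 * LaurentPolynomial.T 1 := by
    rw [← LaurentPolynomial.T_add]; rfl
  ext1 i j
  have hE : (1 + B.qAdj.transpose * B.qAdj : Matrix E₁ E₁ ZQ) i j = (1 : Matrix E₁ E₁ ZQ) i j +
      LaurentPolynomial.C (∑ k, B.adj k i * B.adj k j) * LaurentPolynomial.T 2 := by
    rw [Matrix.add_apply, Matrix.mul_apply, map_sum, Finset.sum_mul, hT]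
    congr 1
    refine Finset.sum_congr rfl fun k _ => ?_
    simp only [qAdj, Matrix.transpose_apply, Matrix.of_apply, map_mul]
    ring
  have hD : dotProduct (B.fundCycle i) (B.fundCycle j) =
      (∑ k, B.adj k i * B.adj k j) + if i = j then 1 else 0 := by
    simp [fundCycle, dotProduct, Pi.single_apply, eq_comm]
  rw [hE]
  by_cases h : i = j
  · subst h
    simp only [gramFlow, Matrix.of_apply, if_true, hD, Matrix.one_apply_eq, add_sub_cancel_right]
  · simp only [gramFlow, Matrix.of_apply, if_neg h, hD, Matrix.one_apply_ne h, add_zero, zero_add]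

/-- The explicit inverse of the Gram matrix `gramP`. -/
theorem gramP_mul_inverse : B.gramP * Matrix.fromBlocks (1 + B.qAdj * B.qAdj.transpose) (-B.qAdj)
    (-B.qAdj.transpose) 1 = 1 := by
  rw [gramP, Matrix.fromBlocks_multiply, gramFlow_eq, ← Matrix.fromBlocks_one]
  simp only [Matrix.mul_neg, Matrix.mul_add, Matrix.add_mul, Matrix.one_mul, Matrix.mul_one,
    Matrix.mul_assoc]
  congr 1 <;> abel

theorem gramP_inv : B.gramP⁻¹ = Matrix.fromBlocks (1 + B.qAdj * B.qAdj.transpose) (-B.qAdj)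
    (-B.qAdj.transpose) 1 :=
  Matrix.inv_eq_right_inv B.gramP_mul_inverse

theorem isUnit_gramP : IsUnit B.gramP :=
  (Matrix.isUnit_iff_isUnit_det _).2 (Matrix.isUnit_det_of_right_inverse B.gramP_mul_inverse)

/-- The Grothendieck group `K₀` (at `t = -1`): the free `ℤ[q, q⁻¹]`-module on the classes `[P_i]`,
`i ∈ E₀ ∪ E₁`. A vector is the family of its coordinates in that basis. -/
abbrev K0 (_B : SignedBipartiteGraph E₀ E₁) : Type _ := E₀ ⊕ E₁ → ZQ

/-- The graded Euler form on `K₀`: the sesquilinear form with Gram matrix `gramP`. -/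
noncomputable def eulerForm : B.K0 →ₛₗ[qbar] B.K0 →ₗ[ZQ] ZQ :=
  LinearMap.mk₂'ₛₗ qbar (RingHom.id ZQ)
    (fun x y => dotProduct (fun i => qbar (x i)) (B.gramP.mulVec y))
    (fun x x' y => by simp [dotProduct, add_mul, Finset.sum_add_distrib])
    (fun c x y => by simp only [dotProduct, Pi.smul_apply, smul_eq_mul, map_mul, mul_assoc,
      Finset.mul_sum])
    (fun x y y' => by simp [Matrix.mulVec_add])
    (fun c x y => by simp [Matrix.mulVec_smul])

/-- The class of the indecomposable projective module `P_i`. -/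
noncomputable def classP (i : E₀ ⊕ E₁) : B.K0 := Pi.single i 1

/-- The class of the simple module `L_i`: the `i`-th column of `gramP⁻¹`. -/
noncomputable def classL (i : E₀ ⊕ E₁) : B.K0 := fun k => B.gramP⁻¹ k i

theorem mulVec_classL (j : E₀ ⊕ E₁) : B.gramP.mulVec (B.classL j) = Pi.single j 1 := by
  funext k
  have h := congrFun (congrFun
    (Matrix.mul_nonsing_inv B.gramP ((Matrix.isUnit_iff_isUnit_det _).1 B.isUnit_gramP)) k) j
  rw [Matrix.mul_apply, Matrix.one_apply] at h
  rw [Pi.single_apply]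
  exact h

theorem eulerForm_classP (i : E₀ ⊕ E₁) (y : B.K0) :
    B.eulerForm (B.classP i) y = B.gramP.mulVec y i := by
  have h : (fun k => qbar (B.classP i k)) = Pi.single i 1 := by
    funext k
    simp only [classP, Pi.single_apply]
    split_ifs <;> simp
  change dotProduct (fun k => qbar (B.classP i k)) (B.gramP.mulVec y) = _
  rw [h, single_one_dotProduct]

/-- `([L_i])` is right dual to `([P_i])`. -/
theorem eulerForm_classP_classL (i j : E₀ ⊕ E₁) :
    B.eulerForm (B.classP i) (B.classL j) = if i = j then 1 else 0 := by
  rw [eulerForm_classP, mulVec_classL, Pi.single_apply]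

theorem eulerForm_classP_classP (i j : E₀ ⊕ E₁) :
    B.eulerForm (B.classP i) (B.classP j) = B.gramP i j := by
  rw [eulerForm_classP, classP, Matrix.mulVec_single_one]
  rfl

theorem eulerForm_classL_classL (i j : E₀ ⊕ E₁) :
    B.eulerForm (B.classL i) (B.classL j) = qbar (B.gramP⁻¹ j i) := by
  change dotProduct (fun k => qbar (B.classL i k)) (B.gramP.mulVec (B.classL j)) = _
  rw [mulVec_classL, dotProduct_single_one]
  rfl

theorem linearIndependent_classP : LinearIndependent ZQ B.classP := by
  have h := (Pi.basisFun ZQ (E₀ ⊕ E₁)).linearIndependent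
  convert h using 1
  funext i
  simp [classP]

theorem linearIndependent_classL : LinearIndependent ZQ B.classL :=
  Matrix.linearIndependent_cols_of_isUnit
    ((Matrix.isUnit_nonsing_inv_iff).2 B.isUnit_gramP)

/-- The basis `([P_i])`, `i ∈ E₁`, of the submodule of `K₀` that these classes generate. -/
noncomputable def basisFlow :
    Module.Basis E₁ ZQ (Submodule.span ZQ (Set.range (B.classP ∘ Sum.inr))) :=
  Module.Basis.span (B.linearIndependent_classP.comp Sum.inr Sum.inr_injective)

/-- The basis `([L_i])`, `i ∈ E₀`, of the submodule of `K₀` that these classes generate. -/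
noncomputable def basisCut :
    Module.Basis E₀ ZQ (Submodule.span ZQ (Set.range (B.classL ∘ Sum.inl))) :=
  Module.Basis.span (B.linearIndependent_classL.comp Sum.inl Sum.inl_injective)

theorem basisFlow_apply (i : E₁) : (B.basisFlow i : B.K0) = B.classP (Sum.inr i) :=
  congrArg Subtype.val (Module.Basis.span_apply _ i)

theorem basisCut_apply (i : E₀) : (B.basisCut i : B.K0) = B.classL (Sum.inl i) :=
  congrArg Subtype.val (Module.Basis.span_apply _ i)

theorem form_basisFlow (i j : E₁) :
    B.eulerForm (B.basisFlow i) (B.basisFlow j) = (1 + B.qAdj.transpose * B.qAdj : Matrix E₁ E₁ ZQ) i j := by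
  rw [basisFlow_apply, basisFlow_apply, eulerForm_classP_classP, gramP, ← gramFlow_eq]
  rfl

theorem form_basisCut (i j : E₀) :
    B.eulerForm (B.basisCut i) (B.basisCut j) =
      qbar ((1 + B.qAdj * B.qAdj.transpose : Matrix E₀ E₀ ZQ) i j) := by
  rw [basisCut_apply, basisCut_apply, eulerForm_classL_classL, gramP_inv,
    Matrix.fromBlocks_apply₁₁]
  congr 1
  simp [Matrix.one_apply, Matrix.mul_apply, eq_comm, mul_comm]

theorem det_one_add_ne_zero {m n : Type*} [Fintype m] [Fintype n] [DecidableEq n]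
    (N : Matrix m n ℤ) : (1 + N.transpose * N).det ≠ 0 := by
  intro h
  obtain ⟨v, hv, hv0⟩ := Matrix.exists_mulVec_eq_zero_iff.2 h
  apply hv
  have h1 : dotProduct v v + dotProduct (N.mulVec v) (N.mulVec v) = 0 := by
    have h2 := congrArg (dotProduct v) hv0
    rw [Matrix.add_mulVec, Matrix.one_mulVec, dotProduct_add, dotProduct_zero,
      ← Matrix.mulVec_mulVec, Matrix.dotProduct_mulVec, Matrix.vecMul_transpose] at h2
    exact h2
  have h2 : 0 ≤ dotProduct v v := Finset.sum_nonneg fun i _ => mul_self_nonneg _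
  have h3 : 0 ≤ dotProduct (N.mulVec v) (N.mulVec v) :=
    Finset.sum_nonneg fun i _ => mul_self_nonneg _
  exact dotProduct_self_eq_zero.1 (by linarith)

/-- Evaluation at `q = 1`. -/
noncomputable def evalOne : ZQ →+* ℤ := LaurentPolynomial.eval₂ (RingHom.id ℤ) 1

theorem map_qAdj_evalOne (B : SignedBipartiteGraph E₀ E₁) : B.qAdj.map evalOne = B.adj := by
  ext i j
  simp [qAdj, evalOne]

theorem map_qAdj_evalOne_qbar (B : SignedBipartiteGraph E₀ E₁) :
    B.qAdj.map (evalOne.comp qbar) = B.adj := by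
  ext i j
  simp [qAdj, evalOne, qbar]

theorem det_flow_ne_zero : (1 + B.qAdj.transpose * B.qAdj).det ≠ 0 := by
  intro h
  have h1 := congrArg evalOne h
  rw [RingHom.map_det, RingHom.mapMatrix_apply, map_zero, Matrix.map_add _ (map_add _),
    Matrix.map_mul, Matrix.transpose_map, map_qAdj_evalOne,
    Matrix.map_one _ (map_zero _) (map_one _)] at h1
  exact det_one_add_ne_zero _ h1

theorem det_cut_ne_zero :
    ((1 + B.qAdj * B.qAdj.transpose).map qbar).det ≠ 0 := by
  intro h
  have h1 := congrArg evalOne h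
  rw [RingHom.map_det, RingHom.mapMatrix_apply, map_zero, Matrix.map_map, ← RingHom.coe_comp,
    Matrix.map_add _ (map_add _), Matrix.map_mul, Matrix.transpose_map, map_qAdj_evalOne_qbar,
    Matrix.map_one _ (map_zero _) (map_one _)] at h1
  have h2 := det_one_add_ne_zero B.adj.transpose
  rw [Matrix.transpose_transpose] at h2
  exact h2 h1

/-- The `q`-flow lattice of a signed bipartite graph: the submodule of `K₀` generated by the classes
`[P_i]`, `i ∈ E₁`, with the inherited form and the `q`-antilinear involution fixing these
classes. -/
noncomputable def qFlow : QLattice :=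
  QLattice.ofBasis B.basisFlow
    (B.eulerForm.domRestrict₁₂ (Submodule.span ZQ (Set.range (B.classP ∘ Sum.inr)))
      (Submodule.span ZQ (Set.range (B.classP ∘ Sum.inr))))
    (fun i j => by
      rw [LinearMap.domRestrict₁₂_apply, LinearMap.domRestrict₁₂_apply, form_basisFlow,
        form_basisFlow]
      simp [Matrix.one_apply, Matrix.mul_apply, eq_comm, mul_comm])
    (by
      simp only [LinearMap.domRestrict₁₂_apply, form_basisFlow]
      exact B.det_flow_ne_zero)

/-- The `q`-cut lattice of a signed bipartite graph: the submodule of `K₀` generated by the classes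
`[L_i]`, `i ∈ E₀`, with the inherited form and the `q`-antilinear involution fixing these
classes. -/
noncomputable def qCut : QLattice :=
  QLattice.ofBasis B.basisCut
    (B.eulerForm.domRestrict₁₂ (Submodule.span ZQ (Set.range (B.classL ∘ Sum.inl)))
      (Submodule.span ZQ (Set.range (B.classL ∘ Sum.inl))))
    (fun i j => by
      rw [LinearMap.domRestrict₁₂_apply, LinearMap.domRestrict₁₂_apply, form_basisCut,
        form_basisCut]
      simp [Matrix.one_apply, Matrix.mul_apply, eq_comm, mul_comm])
    (by
      simp only [LinearMap.domRestrict₁₂_apply, form_basisCut]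
      exact B.det_cut_ne_zero)

end SignedBipartiteGraph

/-! ## Graphs, cycles, spanning trees

`Graph α β` is Mathlib's type of undirected graphs, with loops and multiple edges allowed. -/

namespace Graph

open scoped Graph

variable {α β : Type*}

/-- `Γ` is non-empty and any two vertices are joined by a walk. -/
def IsConnected (Γ : Graph α β) : Prop :=
  V(Γ).Nonempty ∧ ∀ u ∈ V(Γ), ∀ v ∈ V(Γ), Relation.ReflTransGen Γ.Adj u v

/-- `Γ` is connected and stays connected after the removal of any one edge. -/
def IsTwoEdgeConnected (Γ : Graph α β) : Prop :=
  Γ.IsConnected ∧ ∀ e ∈ E(Γ), (Γ.deleteEdges {e}).IsConnected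

/-- An orientation: a choice of a beginning `src e` and an end `tgt e` for each edge `e`. -/
structure Orientation (Γ : Graph α β) where
  src : E(Γ) → α
  tgt : E(Γ) → α
  isLink : ∀ e : E(Γ), Γ.IsLink e (src e) (tgt e)

/-- A cycle with a direction and a base point: it runs through the distinct vertices
`vert 0, …, vert n` and back to `vert 0` (addition in `Fin (n + 1)` is cyclic), along distinct
edges, `edge i` joining `vert i` to `vert (i + 1)`. Its length is `n + 1`; a loop is a cycle of
length one and two parallel edges form a cycle of length two. -/
structure OrientedCycle (Γ : Graph α β) where
  n : ℕ
  vert : Fin (n + 1) → α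
  edge : Fin (n + 1) → E(Γ)
  vert_injective : Function.Injective vert
  edge_injective : Function.Injective edge
  isLink : ∀ i, Γ.IsLink (edge i) (vert i) (vert (i + 1))

/-- The set of edges of a cycle. -/
def OrientedCycle.edges {Γ : Graph α β} (c : Γ.OrientedCycle) : Set E(Γ) := Set.range c.edge

/-- The cycle `c` runs through the edge `e` in the direction given by the orientation. -/
def OrientedCycle.Positive {Γ : Graph α β} (c : Γ.OrientedCycle) (ω : Γ.Orientation)
    (e : E(Γ)) : Prop :=
  ∃ i, c.edge i = e ∧ c.vert i = ω.src e ∧ c.vert (i + 1) = ω.tgt e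

/-- The cycle `c` runs through the edge `e` against the orientation. -/
def OrientedCycle.Negative {Γ : Graph α β} (c : Γ.OrientedCycle) (ω : Γ.Orientation)
    (e : E(Γ)) : Prop :=
  ∃ i, c.edge i = e ∧ c.vert i = ω.tgt e ∧ c.vert (i + 1) = ω.src e

/-- A set of edges is a cycle. -/
def IsCycleEdgeSet (Γ : Graph α β) (C : Set E(Γ)) : Prop :=
  ∃ c : Γ.OrientedCycle, c.edges = C

/-- `T` is (the edge set of) a spanning tree: `T` contains no cycle, and the graph with all
vertices of `Γ` and only the edges in `T` is connected. -/
def IsSpanningTree (Γ : Graph α β) (T : Set E(Γ)) : Prop :=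
  (Γ.restrict (Subtype.val '' T)).IsConnected ∧ ¬ ∃ c : Γ.OrientedCycle, c.edges ⊆ T

open Classical in
/-- The signed bipartite graph `B_{Γ, T}` of a graph with a spanning tree `T` and an orientation.
Its vertices are the edges of `Γ`, with bipartition `E₀ = T`, `E₁ = E ∖ T`. The vertices `i ∈ T`
and `j ∉ T` are adjacent if `i` occurs in the fundamental cycle `C_j`, the cycle contained in
`T ∪ {j}` and directed so that it runs through `j` positively; the sign of the edge is the sign
with which `i` occurs in `C_j`. -/
noncomputable def bipartite (Γ : Graph α β) (ω : Γ.Orientation) (T : Set E(Γ)) :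
    SignedBipartiteGraph T (Tᶜ : Set E(Γ)) where
  sign i j :=
    if ∃ c : Γ.OrientedCycle, c.edges ⊆ insert j.1 T ∧ c.Positive ω j ∧ c.Positive ω i then 1
    else if ∃ c : Γ.OrientedCycle, c.edges ⊆ insert j.1 T ∧ c.Positive ω j ∧ c.Negative ω i then -1
    else 0

open Classical in
/-- The `q`-flow lattice of a finite graph with a spanning tree. -/
noncomputable def qFlow (Γ : Graph α β) [Finite E(Γ)] (ω : Γ.Orientation) (T : Set E(Γ)) :
    QLattice :=
  letI : Fintype E(Γ) := Fintype.ofFinite _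
  (Γ.bipartite ω T).qFlow

open Classical in
/-- The `q`-cut lattice of a finite graph with a spanning tree. -/
noncomputable def qCut (Γ : Graph α β) [Finite E(Γ)] (ω : Γ.Orientation) (T : Set E(Γ)) :
    QLattice :=
  letI : Fintype E(Γ) := Fintype.ofFinite _
  (Γ.bipartite ω T).qCut

/-- `F` is a cycle-preserving bijection between the edge sets: a set of edges is a cycle if and only
if its image is one. -/
def CyclePreserving {α' β' : Type*} {Γ : Graph α β} {Γ' : Graph α' β'} (F : E(Γ) ≃ E(Γ')) :
    Prop :=
  ∀ C : Set E(Γ), Γ'.IsCycleEdgeSet (F '' C) ↔ Γ.IsCycleEdgeSet C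

end Graph

/-! ## Totally unimodular integer matrices and their Gram matrices -/

/-! Write `A` for the signed matrix `(ε_ij)` of a graph with a spanning tree. The integral flows are
exactly the vectors whose tree coordinates are `A` times their other coordinates, and the cycles are
the minimal supports of nonzero flows. The theorem holds because each of its three conditions says
that the two matrices `A` agree up to permutations and sign changes of rows and columns.

From isomorphisms to matrices. The flow and cut lattices have Gram matrices `1 + q² AᵗA` and `1 +
q⁻² AAᵗ`. If `U*(1 + qᵏN')U = 1 + qᵏN` with `k ≠ 0` and `N`, `N'` symmetric, then comparison with
the conjugate transpose separates the two terms: `U*U = 1` and `U*N'U = N`. At `q = 1` this makes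
`U` an integral orthogonal matrix, that is, a signed permutation (`exists_signed_perm_of_form_eq`).
So `AᵗA`, respectively `AAᵗ`, is known up to a signed permutation.

It remains to recover `A`. It is totally unimodular (`isTotallyUnimodular_adj`), and such a matrix
without zero rows is determined by `AᵗA` up to signed row permutations (`exists_equiv_of_gram_eq`).
Entries of `AᵗA` count the rows that meet one or two given columns. For a set `S` of at least three
compatibly signed columns, one column must be redundant in the condition of meeting all of `S`:
otherwise a submatrix equals, up to signs, the identity minus the all-ones matrix, of determinant `1
- |S|`. Thus all such counts are determined, hence the number of rows of each support; the signs
within a row come from the signs of the Gram matrix. Two-edge-connectedness excludes zero rows;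
looplessness excludes zero columns, as the transposed argument for cuts requires.

From bijections to isomorphisms. A cycle-preserving bijection that matches the trees matches the
fundamental cycles, so the two matrices have the same support. By Camion's theorem
(`exists_signs_of_support_eq`) they then agree up to signs. The resulting signed permutations of the
bases are isometries that commute with `d`, which gives the stronger version as well. -/

namespace Matrix

variable {m n : Type*} {M : Matrix m n ℤ}

theorem IsTotallyUnimodular.det_submatrix_cases (hM : M.IsTotallyUnimodular) {k : Type*}
    [Fintype k] [DecidableEq k] (f : k → m) (g : k → n) :
    (M.submatrix f g).det = 0 ∨ (M.submatrix f g).det = 1 ∨ (M.submatrix f g).det = -1 := by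
  obtain ⟨s, hs⟩ := (isTotallyUnimodular_iff_fintype M).1 hM k f g
  rw [← hs]
  cases s <;> simp

theorem IsTotallyUnimodular.entry_cases (hM : M.IsTotallyUnimodular) (i : m) (j : n) :
    M i j = 0 ∨ M i j = 1 ∨ M i j = -1 := by
  obtain ⟨s, hs⟩ := hM.apply i j
  rw [← hs]
  cases s <;> simp

theorem IsTotallyUnimodular.mul_self_entry (hM : M.IsTotallyUnimodular) {i : m} {j : n}
    (h : M i j ≠ 0) : M i j * M i j = 1 := by
  rcases hM.entry_cases i j with h' | h' | h' <;> simp_all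

/-- Two rows that are both nonzero at two columns agree up to sign there. -/
theorem IsTotallyUnimodular.mul_entry_eq (hM : M.IsTotallyUnimodular) {a b : m} {j k : n}
    (haj : M a j ≠ 0) (hak : M a k ≠ 0) (hbj : M b j ≠ 0) (hbk : M b k ≠ 0) :
    M a j * M a k = M b j * M b k := by
  have hd := hM.det_submatrix_cases ![a, b] ![j, k]
  rw [det_fin_two] at hd
  simp only [submatrix_apply, cons_val_zero, cons_val_one] at hd
  rcases hM.entry_cases a j with h1 | h1 | h1 <;> rcases hM.entry_cases a k with h2 | h2 | h2 <;>
    rcases hM.entry_cases b j with h3 | h3 | h3 <;>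
    rcases hM.entry_cases b k with h4 | h4 | h4 <;> simp_all

theorem IsTotallyUnimodular.scale_cols (hM : M.IsTotallyUnimodular) (c : n → ℤˣ) :
    (of fun i j => (c j : ℤ) * M i j).IsTotallyUnimodular := by
  rw [isTotallyUnimodular_iff]
  intro k f g
  have h : ((of fun i j => (c j : ℤ) * M i j).submatrix f g).det =
      (∏ a, (c (g a) : ℤ)) * (M.submatrix f g).det := by
    rw [← det_mul_row]
    rfl
  have h1 : (∏ a, (c (g a) : ℤ)) = ((∏ a, c (g a) : ℤˣ) : ℤ) := by push_cast; rfl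
  rw [h, h1]
  rcases Int.units_eq_one_or (∏ a, c (g a)) with h2 | h2 <;>
    rcases hM.det_submatrix_cases f g with h3 | h3 | h3 <;> rw [h2, h3]
  exacts [⟨0, by simp⟩, ⟨1, by simp⟩, ⟨-1, by simp⟩, ⟨0, by simp⟩, ⟨-1, by simp⟩, ⟨1, by simp⟩]

/-- The matrix is a rank-one perturbation of the identity. From size three on, the determinant is at
most `-2`, which total unimodularity forbids. -/
theorem det_one_sub_replicate (k : Type*) [Fintype k] [DecidableEq k] :
    (of fun i j : k => if i = j then (0 : ℤ) else -1).det = 1 - Fintype.card k := by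
  have h := det_one_add_replicateCol_mul_replicateRow (ι := Unit) (fun _ : k => (-1 : ℤ))
    (fun _ => (1 : ℤ))
  have h1 : (of fun i j : k => if i = j then (0 : ℤ) else -1) =
      1 + replicateCol Unit (fun _ : k => (-1 : ℤ)) * replicateRow Unit (fun _ : k => (1 : ℤ)) := by
    ext i j
    by_cases hij : i = j <;> simp [hij, mul_apply]
  rw [h1, h]
  simp [dotProduct]
  ring

/-- A totally unimodular matrix has no submatrix of size at least three that up to signs of rows
and columns has zeros on the diagonal and ones off the diagonal. -/
theorem IsTotallyUnimodular.card_le_two_of_antidiagonal (hM : M.IsTotallyUnimodular) (S : Finset n)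
    (f : S → m) (s : n → ℤˣ) (hdiag : ∀ j : S, M (f j) j = 0)
    (hoff : ∀ j k l : S, k ≠ j → l ≠ j → M (f j) k * M (f j) l = s k * s l)
    (hne : ∀ j k : S, k ≠ j → M (f j) k ≠ 0) : S.card ≤ 2 := by
  classical
  by_contra! hS
  have hcard : 1 < Fintype.card S := by rw [Fintype.card_coe]; omega
  have : Nontrivial S := Fintype.one_lt_card_iff_nontrivial.1 hcard
  choose o ho using fun j : S => exists_ne j
  have hso : ∀ j, (s j : ℤ) * s j = 1 := fun j => by
    rw [← Units.val_mul, Int.units_mul_self]; rfl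
  -- The reference column `o j ≠ j` fixes the sign of the row `f j`. With row and column signs
  -- extracted, only the identity minus the all-ones matrix remains.
  have hE : M.submatrix f (fun k : S => k.1) =
      of fun j k : S => (-(s (o j) : ℤ) * M (f j) (o j)) * (of fun j k : S => (s k : ℤ) *
        (of fun i j : S => if i = j then (0 : ℤ) else -1) j k) j k := by
    ext j k
    simp only [submatrix_apply, of_apply]
    by_cases hjk : j = k
    · subst hjk; simp [hdiag]
    · have h1 := hoff j k (o j) (Ne.symm hjk) (ho j)
      have h2 := hM.mul_self_entry (hne j (o j) (ho j))
      rw [if_neg hjk]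
      linear_combination (M (f j) (o j)) * h1 - M (f j) k * h2
  have hd := hM.det_submatrix_cases f (fun k : S => k.1)
  have hu1 : IsUnit (∏ j : S, (-(s (o j) : ℤ) * M (f j) (o j))) := by
    rw [IsUnit.prod_univ_iff]
    intro j
    have := hM.mul_self_entry (hne j (o j) (ho j))
    exact ((s (o j)).isUnit.neg).mul (IsUnit.of_mul_eq_one _ this)
  have hu2 : IsUnit (∏ j : S, (s j : ℤ)) := by
    rw [IsUnit.prod_univ_iff]
    exact fun j => (s j).isUnit
  rw [hE, det_mul_column, det_mul_row, det_one_sub_replicate, Fintype.card_coe] at hd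
  rw [Int.isUnit_iff] at hu1 hu2
  rcases hu1 with h1 | h1 <;> rcases hu2 with h2 | h2 <;> rw [h1, h2] at hd <;> omega

/-- The support of a row. -/
noncomputable def rowSupport [Fintype n] (M : Matrix m n ℤ) (i : m) : Finset n :=
  open Classical in Finset.univ.filter fun j => M i j ≠ 0

theorem mem_rowSupport [Fintype n] {M : Matrix m n ℤ} {i : m} {j : n} :
    j ∈ M.rowSupport i ↔ M i j ≠ 0 := by
  classical simp [rowSupport]

variable [Fintype m]

/-- The number of rows whose support contains `S`. -/
noncomputable def rowCount (M : Matrix m n ℤ) (S : Finset n) : ℕ :=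
  open Classical in (Finset.univ.filter fun i => ∀ j ∈ S, M i j ≠ 0).card

theorem rowCount_anti (M : Matrix m n ℤ) {S S' : Finset n} (h : S ⊆ S') :
    M.rowCount S' ≤ M.rowCount S := by
  classical
  refine Finset.card_le_card fun i => ?_
  simp only [Finset.mem_filter, Finset.mem_univ, true_and]
  exact fun hi j hj => hi j (h hj)

theorem rowCount_pos {M : Matrix m n ℤ} {S : Finset n} :
    0 < M.rowCount S ↔ ∃ i, ∀ j ∈ S, M i j ≠ 0 := by
  classical
  simp [rowCount, Finset.card_pos, Finset.Nonempty]

theorem exists_row_of_rowCount_lt {M : Matrix m n ℤ} {S S' : Finset n}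
    (h : M.rowCount S' < M.rowCount S) :
    ∃ i, (∀ j ∈ S, M i j ≠ 0) ∧ ∃ j ∈ S', M i j = 0 := by
  classical
  by_contra! hc
  refine absurd (Finset.card_le_card fun i => ?_) h.not_ge
  simp only [Finset.mem_filter, Finset.mem_univ, true_and]
  exact fun hi => hc i hi

/-- No cancellation occurs in the inner product: by `mul_entry_eq`, all rows that meet both columns
contribute the same sign. -/
theorem IsTotallyUnimodular.gram_eq [DecidableEq n] (hM : M.IsTotallyUnimodular) {i : m} {j k : n}
    (hj : M i j ≠ 0) (hk : M i k ≠ 0) :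
    (Mᵀ * M) j k = M i j * M i k * M.rowCount {j, k} := by
  classical
  rw [mul_apply, rowCount, Finset.card_filter, Nat.cast_sum, Finset.mul_sum]
  refine Finset.sum_congr rfl fun a _ => ?_
  rw [transpose_apply]
  by_cases h : M a j ≠ 0 ∧ M a k ≠ 0
  · rw [if_pos (by simpa using h), hM.mul_entry_eq h.1 h.2 hj hk]; simp
  · rw [if_neg (by simpa using h)]
    rw [not_and_or, not_not, not_not] at h
    rcases h with h | h <;> simp [h]

theorem IsTotallyUnimodular.natAbs_gram [DecidableEq n] (hM : M.IsTotallyUnimodular) (j k : n) :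
    ((Mᵀ * M) j k).natAbs = M.rowCount {j, k} := by
  classical
  by_cases h : ∃ i, ∀ a ∈ ({j, k} : Finset n), M i a ≠ 0
  · obtain ⟨i, hi⟩ := h
    have hj := hi j (by simp)
    have hk := hi k (by simp)
    rw [hM.gram_eq hj hk]
    rcases hM.entry_cases i j with h1 | h1 | h1 <;> rcases hM.entry_cases i k with h2 | h2 | h2 <;>
      simp_all
  · have h0 : M.rowCount {j, k} = 0 := by
      by_contra h0
      exact h (rowCount_pos.1 (Nat.pos_of_ne_zero h0))
    rw [h0, Int.natAbs_eq_zero, mul_apply]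
    refine Finset.sum_eq_zero fun a _ => ?_
    by_contra hne
    refine h ⟨a, ?_⟩
    simpa [transpose_apply] using hne

theorem IsTotallyUnimodular.sign_gram [DecidableEq n] (hM : M.IsTotallyUnimodular) {i : m} {j k : n}
    (hj : M i j ≠ 0) (hk : M i k ≠ 0) : ((Mᵀ * M) j k).sign = M i j * M i k := by
  have h : 0 < M.rowCount {j, k} := rowCount_pos.2 ⟨i, by simp [hj, hk]⟩
  rw [hM.gram_eq hj hk, Int.sign_mul, Int.sign_eq_one_of_pos
    (a := (M.rowCount {j, k} : ℤ)) (by exact_mod_cast h), mul_one]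
  rcases hM.entry_cases i j with h1 | h1 | h1 <;> rcases hM.entry_cases i k with h2 | h2 | h2 <;>
    simp_all

/-- If a row meets all columns in `S`, then the columns in `S` are compatibly directed. -/
theorem IsTotallyUnimodular.gram_triple_pos [DecidableEq n] (hM : M.IsTotallyUnimodular)
    {S : Finset n} (hS : 0 < M.rowCount S) {a b c : n} (ha : a ∈ S) (hb : b ∈ S) (hc : c ∈ S) :
    0 < (Mᵀ * M) a b * (Mᵀ * M) b c * (Mᵀ * M) a c := by
  obtain ⟨i, hi⟩ := rowCount_pos.1 hS
  rw [← Int.sign_eq_one_iff_pos, Int.sign_mul, Int.sign_mul, hM.sign_gram (hi a ha) (hi b hb),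
    hM.sign_gram (hi b hb) (hi c hc), hM.sign_gram (hi a ha) (hi c hc)]
  linear_combination (M i b * M i b * M i c * M i c) * hM.mul_self_entry (hi a ha) +
    (M i c * M i c) * hM.mul_self_entry (hi b hb) + hM.mul_self_entry (hi c hc)

/-- If at least three columns are compatibly directed, then one of them is redundant in the
condition that a row meets all of them. -/
theorem IsTotallyUnimodular.exists_rowCount_erase [DecidableEq n] (hM : M.IsTotallyUnimodular)
    {S : Finset n} (hS : 3 ≤ S.card)
    (hpos : ∀ a ∈ S, ∀ b ∈ S, ∀ c ∈ S, 0 < (Mᵀ * M) a b * (Mᵀ * M) b c * (Mᵀ * M) a c) :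
    ∃ j ∈ S, M.rowCount (S.erase j) = M.rowCount S := by
  by_contra! hne
  have hlt : ∀ j ∈ S, M.rowCount S < M.rowCount (S.erase j) := fun j hj =>
    lt_of_le_of_ne (M.rowCount_anti (Finset.erase_subset _ _)) (hne j hj).symm
  -- If no column is redundant, then for each `j` some row meets all of `S` except precisely `j`.
  choose f hf using fun j : S => exists_row_of_rowCount_lt (hlt j j.2)
  have hdiag : ∀ j : S, M (f j) j = 0 := fun j => by
    obtain ⟨k, hk, hk0⟩ := (hf j).2
    by_cases h : k = j
    · rwa [h] at hk0
    · exact absurd hk0 ((hf j).1 k (Finset.mem_erase.2 ⟨h, hk⟩))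
  have hoff : ∀ j k : S, k ≠ j → M (f j) k ≠ 0 := fun j k hk =>
    (hf j).1 k (Finset.mem_erase.2 ⟨fun h => hk (Subtype.ext h), k.2⟩)
  obtain ⟨o, ho⟩ := Finset.card_pos.1 (by omega : 0 < S.card)
  have hsign : ∀ k ∈ S, ((Mᵀ * M) o k).sign = 1 ∨ ((Mᵀ * M) o k).sign = -1 := fun k hk => by
    have h := hpos o ho o ho k hk
    have h0 : (Mᵀ * M) o k ≠ 0 := fun h0 => by simp [h0] at h
    rcases lt_or_gt_of_ne h0 with h1 | h1
    · exact Or.inr (Int.sign_eq_neg_one_of_neg h1)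
    · exact Or.inl (Int.sign_eq_one_of_pos h1)
  have := hM.card_le_two_of_antidiagonal S f
    (fun k => if ((Mᵀ * M) o k).sign = 1 then 1 else -1) hdiag (fun j k l hk hl => ?_) hoff
  · omega
  -- Positivity of the triple `o, k, l` says that the sign of the entry `(k, l)` is the product of
  -- the signs relative to the base column `o`.
  · have h := hpos o ho k k.2 l l.2
    rw [← hM.sign_gram (hoff j k hk) (hoff j l hl)]
    rw [← Int.sign_eq_one_iff_pos, Int.sign_mul, Int.sign_mul] at h
    rcases hsign k k.2 with h1 | h1 <;> rcases hsign l l.2 with h2 | h2 <;> rw [h1, h2] at h ⊢ <;>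
      generalize ((Mᵀ * M) (k : n) (l : n)).sign = t at h ⊢ <;> simp at h ⊢ <;> omega

variable {m' : Type*} [Fintype m'] {M' : Matrix m' n ℤ}

/-- Induction on `S`. One or two columns are covered by the absolute values of the Gram entries. For
more columns the Gram matrix decides whether they are compatibly directed: if not, both counts
vanish; if so, a redundant column reduces the count to a smaller set. -/
theorem IsTotallyUnimodular.rowCount_eq_of_gram_eq [DecidableEq n] (hM : M.IsTotallyUnimodular)
    (hM' : M'.IsTotallyUnimodular) (h : Mᵀ * M = M'ᵀ * M') {S : Finset n} (hS : S.Nonempty) :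
    M.rowCount S = M'.rowCount S := by
  induction S using Finset.strongInduction with
  | H S ih =>
    have herase : ∀ j ∈ S, 3 ≤ S.card → M.rowCount (S.erase j) = M'.rowCount (S.erase j) :=
      fun j hj hc => ih _ (Finset.erase_ssubset hj)
        (Finset.card_pos.1 (by rw [Finset.card_erase_of_mem hj]; omega))
    by_cases hc : 3 ≤ S.card
    · by_cases hpos : ∀ a ∈ S, ∀ b ∈ S, ∀ c ∈ S,
          0 < (Mᵀ * M) a b * (Mᵀ * M) b c * (Mᵀ * M) a c
      -- The redundant columns of `M` and `M'` may differ, so each of them yields only one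
      -- inequality.
      · apply le_antisymm
        · obtain ⟨j, hj, hj'⟩ := hM'.exists_rowCount_erase hc (h ▸ hpos)
          rw [← hj', ← herase j hj hc]
          exact M.rowCount_anti (Finset.erase_subset _ _)
        · obtain ⟨j, hj, hj'⟩ := hM.exists_rowCount_erase hc hpos
          rw [← hj', herase j hj hc]
          exact M'.rowCount_anti (Finset.erase_subset _ _)
      · have h1 : M.rowCount S = 0 := by
          by_contra h0
          exact hpos fun a ha b hb c hc => hM.gram_triple_pos (Nat.pos_of_ne_zero h0) ha hb hc
        have h2 : M'.rowCount S = 0 := by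
          by_contra h0
          exact hpos fun a ha b hb c hc =>
            h ▸ hM'.gram_triple_pos (Nat.pos_of_ne_zero h0) ha hb hc
        rw [h1, h2]
    · have hc1 := hS.card_pos
      have hpair : ∃ j k, S = {j, k} := by
        have : S.card = 1 ∨ S.card = 2 := by omega
        rcases this with h1 | h1
        · obtain ⟨j, rfl⟩ := Finset.card_eq_one.1 h1
          exact ⟨j, j, by simp⟩
        · obtain ⟨j, k, -, rfl⟩ := Finset.card_eq_two.1 h1
          exact ⟨j, k, rfl⟩
      obtain ⟨j, k, rfl⟩ := hpair
      rw [← hM.natAbs_gram, ← hM'.natAbs_gram, h]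

theorem rowCount_eq_sum [Fintype n] [DecidableEq n] (M : Matrix m n ℤ) (S : Finset n) :
    M.rowCount S = ∑ S' ∈ Finset.univ.filter (S ⊆ ·), Fintype.card {i // M.rowSupport i = S'} := by
  classical
  rw [rowCount, Finset.card_eq_sum_card_fiberwise (f := M.rowSupport)
    (t := Finset.univ.filter (S ⊆ ·))]
  · refine Finset.sum_congr rfl fun S' hS' => ?_
    rw [Fintype.card_subtype]
    congr 1
    ext i
    simp only [Finset.mem_filter, Finset.mem_univ, true_and] at hS' ⊢
    refine ⟨fun h => h.2, fun h => ⟨fun j hj => ?_, h⟩⟩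
    rw [← mem_rowSupport, h]
    exact hS' hj
  · intro i hi
    simp only [Finset.coe_filter, Finset.mem_univ, true_and, Set.mem_ofPred_eq] at hi ⊢
    exact fun j hj => mem_rowSupport.2 (hi j hj)

/-- Möbius inversion over the sets containing `S`, done as an induction from large sets to small
ones: after cancellation of the strict supersets only the rows of support exactly `S` remain. -/
theorem card_rowSupport_eq [Fintype n] [DecidableEq n]
    (h : ∀ S : Finset n, S.Nonempty → M.rowCount S = M'.rowCount S) {S : Finset n}
    (hS : S.Nonempty) :
    Fintype.card {i // M.rowSupport i = S} = Fintype.card {i // M'.rowSupport i = S} := by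
  induction hk : Fintype.card n - S.card using Nat.strong_induction_on generalizing S with
  | _ k ih =>
    have hS' := h S hS
    rw [rowCount_eq_sum, rowCount_eq_sum] at hS'
    rw [← Finset.add_sum_erase _ _ (show S ∈ Finset.univ.filter (S ⊆ ·) by simp),
      ← Finset.add_sum_erase _ _ (show S ∈ Finset.univ.filter (S ⊆ ·) by simp)] at hS'
    rw [Finset.sum_congr rfl fun S' hmem => ?_] at hS'
    · exact Nat.add_right_cancel hS'
    · rw [Finset.mem_erase, Finset.mem_filter] at hmem
      have hlt := Finset.card_lt_card (Finset.ssubset_iff_subset_ne.2 ⟨hmem.2.2, hmem.1.symm⟩)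
      have hle := Finset.card_le_univ S'
      exact ih _ (by omega) (hS.mono hmem.2.2) rfl

theorem exists_equiv_rowSupport [Fintype n] [DecidableEq n] (h0 : ∀ i, ∃ j, M i j ≠ 0)
    (h0' : ∀ i, ∃ j, M' i j ≠ 0)
    (h : ∀ S : Finset n, S.Nonempty → M.rowCount S = M'.rowCount S) :
    ∃ σ : m ≃ m', ∀ i, M'.rowSupport (σ i) = M.rowSupport i := by
  have hc : ∀ S : Finset n,
      Nonempty ({i // M.rowSupport i = S} ≃ {i // M'.rowSupport i = S}) := fun S => by
    rw [← Fintype.card_eq]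
    rcases S.eq_empty_or_nonempty with rfl | hS
    · have e1 : IsEmpty {i // M.rowSupport i = ∅} := ⟨fun ⟨i, hi⟩ => by
        obtain ⟨j, hj⟩ := h0 i
        rw [← mem_rowSupport, hi] at hj
        simp at hj⟩
      have e2 : IsEmpty {i // M'.rowSupport i = ∅} := ⟨fun ⟨i, hi⟩ => by
        obtain ⟨j, hj⟩ := h0' i
        rw [← mem_rowSupport, hi] at hj
        simp at hj⟩
      simp
    · exact card_rowSupport_eq h hS
  have e := fun S => (hc S).some
  refine ⟨(Equiv.sigmaFiberEquiv M.rowSupport).symm.trans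
    ((Equiv.sigmaCongrRight e).trans (Equiv.sigmaFiberEquiv M'.rowSupport)), fun i => ?_⟩
  exact (e _ _).2

/-- A totally unimodular matrix without zero rows is determined by its Gram matrix up to
permutations and changes of sign of the rows. -/
theorem IsTotallyUnimodular.exists_equiv_of_gram_eq [Fintype n] [DecidableEq n]
    (hM : M.IsTotallyUnimodular) (hM' : M'.IsTotallyUnimodular) (h0 : ∀ i, ∃ j, M i j ≠ 0)
    (h0' : ∀ i, ∃ j, M' i j ≠ 0) (h : Mᵀ * M = M'ᵀ * M') :
    ∃ (σ : m ≃ m') (r : m → ℤˣ), ∀ i j, M' (σ i) j = r i * M i j := by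
  obtain ⟨σ, hσ⟩ := exists_equiv_rowSupport h0 h0' fun S hS => hM.rowCount_eq_of_gram_eq hM' h hS
  have hsupp : ∀ i j, M' (σ i) j ≠ 0 ↔ M i j ≠ 0 := fun i j => by
    rw [← mem_rowSupport, ← mem_rowSupport, hσ]
  have hrow : ∀ i, ∃ u : ℤˣ, ∀ j, M' (σ i) j = u * M i j := fun i => by
    obtain ⟨k, hk⟩ := h0 i
    have hk' := (hsupp i k).2 hk
    have h1 := hM.mul_self_entry hk
    have h2 := hM'.mul_self_entry hk'
    -- The sign is read off at the pivot column `k`; equal Gram signs carry it to the other columns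
    -- that meet the row.
    refine ⟨⟨M i k * M' (σ i) k, M i k * M' (σ i) k, ?_, ?_⟩, fun j => ?_⟩
    · linear_combination (M' (σ i) k * M' (σ i) k) * h1 + h2
    · linear_combination (M' (σ i) k * M' (σ i) k) * h1 + h2
    · by_cases hj : M i j = 0
      · rw [hj, mul_zero]
        by_contra hne
        exact (hsupp i j).1 hne hj
      · have h3 := hM.sign_gram hk hj
        have h4 := hM'.sign_gram hk' ((hsupp i j).2 hj)
        rw [h, h4] at h3
        show _ = M i k * M' (σ i) k * M i j
        linear_combination -M' (σ i) j * h2 + M' (σ i) k * h3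
  choose r hr using hrow
  exact ⟨σ, r, hr⟩

/-- The same up to permutations and changes of sign of the columns. -/
theorem IsTotallyUnimodular.exists_equiv_of_gram_equiv {n' : Type*} [Fintype n] [Fintype n']
    {M' : Matrix m' n' ℤ} (hM : M.IsTotallyUnimodular) (hM' : M'.IsTotallyUnimodular)
    (h0 : ∀ i, ∃ j, M i j ≠ 0) (h0' : ∀ i, ∃ j, M' i j ≠ 0) (τ : n ≃ n') (c : n → ℤˣ)
    (h : ∀ j k, (M'ᵀ * M') (τ j) (τ k) = c j * c k * (Mᵀ * M) j k) :
    ∃ (σ : m ≃ m') (r : m → ℤˣ), ∀ i j, M' (σ i) (τ j) = r i * c j * M i j := by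
  classical
  have hcc : ∀ j, (c j : ℤ) * c j = 1 := fun j => by
    rw [← Units.val_mul, Int.units_mul_self]; rfl
  obtain ⟨σ, r, hr⟩ := hM.exists_equiv_of_gram_eq ((hM'.submatrix id τ).scale_cols c) h0
    (fun i => by
      obtain ⟨j, hj⟩ := h0' i
      exact ⟨τ.symm j, by simpa using hj⟩) (by
      ext j k
      have h1 := h j k
      simp only [mul_apply, transpose_apply, of_apply, submatrix_apply, id] at h1 ⊢
      have h2 : ∑ x, (c j : ℤ) * M' x (τ j) * (c k * M' x (τ k)) =
          c j * c k * ∑ x, M' x (τ j) * M' x (τ k) := by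
        rw [Finset.mul_sum]
        exact Finset.sum_congr rfl fun _ _ => by ring
      rw [h2, h1]
      linear_combination -(∑ x, M x j * M x k) * ((c k * c k : ℤ) * hcc j + hcc k))
  refine ⟨σ, r, fun i j => ?_⟩
  have h1 := hr i j
  simp only [of_apply, submatrix_apply, id] at h1
  linear_combination (c j : ℤ) * h1 - M' (σ i) (τ j) * hcc j

end Matrix

/-! ### Determinants of cycles and Camion's theorem -/

namespace Matrix

theorem IsTotallyUnimodular.isUnit_of_ne_zero {m n : Type*} {M : Matrix m n ℤ}
    (hM : M.IsTotallyUnimodular) {i : m} {j : n} (h : M i j ≠ 0) : IsUnit (M i j) :=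
  IsUnit.of_mul_eq_one _ (hM.mul_self_entry h)

/-- Expansion of the determinant of the matrix of a cycle along its first column; the coefficients
depend only on the other columns. -/
theorem exists_det_eq_of_cyclic {l : ℕ} (hl : l ≠ 0) (B : Matrix (Fin (l + 1)) (Fin l) ℤ)
    (hB : ∀ t s, B t s ≠ 0 → t = s.castSucc ∨ t = s.succ)
    (hunit : ∀ s : Fin l, IsUnit (B s.castSucc s) ∧ IsUnit (B s.succ s)) :
    ∃ p q : ℤ, IsUnit p ∧ IsUnit q ∧ ∀ b : Fin (l + 1) → ℤ,
      (∀ t, t ≠ 0 → t ≠ Fin.last l → b t = 0) →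
      (of fun t => Fin.cons (b t) (B t) : Matrix (Fin (l + 1)) (Fin (l + 1)) ℤ).det =
        b 0 * p + b (Fin.last l) * q := by
  -- Only the minors that omit the first or the last row matter. Since column `s` of `B` lives in
  -- the rows `s` and `s + 1`, both are triangular with units on the diagonal.
  refine ⟨(B.submatrix Fin.succ id).det,
    (-1) ^ l * (B.submatrix Fin.castSucc id).det, ?_, ?_, fun b hb => ?_⟩
  · rw [det_of_isUpperTriangular, IsUnit.prod_univ_iff]
    · exact fun s => (hunit s).2
    · intro a c hac
      by_contra h
      have hac' : c < a := hac
      rcases hB _ _ h with h1 | h1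
      · have := congrArg Fin.val h1
        simp at this
        omega
      · exact hac'.ne' (Fin.succ_injective _ h1)
  · refine ((isUnit_one.neg).pow l).mul ?_
    rw [det_of_isLowerTriangular, IsUnit.prod_univ_iff]
    · exact fun s => (hunit s).1
    · intro a c hac
      by_contra h
      have hac' : a < c := hac
      rcases hB _ _ h with h1 | h1
      · exact hac'.ne (Fin.castSucc_injective _ h1)
      · have := congrArg Fin.val h1
        simp at this
        omega
  · rw [det_succ_column_zero]
    have h0 : (0 : Fin (l + 1)) ≠ Fin.last l := fun h => hl (by
      have := congrArg Fin.val h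
      simpa using this.symm)
    rw [Finset.sum_eq_add_of_mem 0 (Fin.last l) (Finset.mem_univ _) (Finset.mem_univ _) h0
      (fun t _ ht => by simp [hb t ht.1 ht.2])]
    have e1 : ((of fun t => Fin.cons (b t) (B t) : Matrix (Fin (l + 1)) (Fin (l + 1)) ℤ).submatrix
        (Fin.succAbove 0) Fin.succ) = B.submatrix Fin.succ id := by
      ext; simp
    have e2 : ((of fun t => Fin.cons (b t) (B t) : Matrix (Fin (l + 1)) (Fin (l + 1)) ℤ).submatrix
        (Fin.succAbove (Fin.last l)) Fin.succ) = B.submatrix Fin.castSucc id := by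
      ext; simp
    rw [e1, e2]
    simp
    ring

variable {m n : Type*} {M M' : Matrix m n ℤ}

/-- Two rows are adjacent if some column in `J` meets both. -/
def rowGraph (M : Matrix m n ℤ) (J : Set n) : SimpleGraph m where
  Adj a b := a ≠ b ∧ ∃ j ∈ J, M a j ≠ 0 ∧ M b j ≠ 0
  symm := ⟨fun _ _ ⟨h, j, hj, h1, h2⟩ => ⟨h.symm, j, hj, h2, h1⟩⟩
  loopless := ⟨fun _ h => h.1 rfl⟩

/-- If two totally unimodular matrices of the same support agree in the columns in `J`, then in any
other column the ratio of their entries is constant on the components of the row graph of `J`. -/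
theorem IsTotallyUnimodular.ratio_eq_of_reachable (hM : M.IsTotallyUnimodular)
    (hM' : M'.IsTotallyUnimodular) {J : Set n} (hJ : ∀ i, ∀ j ∈ J, M i j = M' i j) {k : n}
    (hk : ∀ i, M i k = 0 ↔ M' i k = 0) {a b : m} (hab : (M.rowGraph J).Reachable a b)
    (ha : M a k ≠ 0) (hb : M b k ≠ 0) : M' a k * M a k = M' b k * M b k := by
  classical
  by_contra hne
  -- A counterexample at minimal distance, over all pairs of rows, is chosen; a shortest path
  -- between its ends is then an induced path.
  have hex : ∃ d a b, (M.rowGraph J).Reachable a b ∧ (M.rowGraph J).dist a b = d ∧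
      M a k ≠ 0 ∧ M b k ≠ 0 ∧ M' a k * M a k ≠ M' b k * M b k :=
    ⟨_, a, b, hab, rfl, ha, hb, hne⟩
  clear hne ha hb hab a b
  obtain ⟨a, b, hab, hd, ha, hb, hne⟩ := Nat.find_spec hex
  have hmin : ∀ a' b', (M.rowGraph J).Reachable a' b' →
      (M.rowGraph J).dist a' b' < (M.rowGraph J).dist a b → M a' k ≠ 0 → M b' k ≠ 0 →
      M' a' k * M a' k = M' b' k * M b' k := by
    intro a' b' hr hlt ha' hb'
    by_contra hne'
    exact Nat.find_min hex (hd ▸ hlt) ⟨a', b', hr, rfl, ha', hb', hne'⟩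
  obtain ⟨p, hp⟩ := hab.exists_walk_length_eq_dist
  have hl : p.length ≠ 0 := fun h => by
    have := SimpleGraph.Walk.eq_of_length_eq_zero h
    subst this
    exact hne rfl
  have hreach : ∀ t, (M.rowGraph J).Reachable a (p.getVert t) := fun t => ⟨p.take t⟩
  have hdist : ∀ t ≤ p.length, (M.rowGraph J).dist a (p.getVert t) = t ∧
      (M.rowGraph J).dist (p.getVert t) b = p.length - t := fun t ht => by
    have h1 := (M.rowGraph J).dist_le (p.take t)
    have h2 := (M.rowGraph J).dist_le (p.drop t)
    have h3 := (hreach t).dist_triangle_left b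
    rw [SimpleGraph.Walk.take_length] at h1
    rw [SimpleGraph.Walk.drop_length] at h2
    omega
  have hclose : ∀ s ≤ p.length, ∀ t ≤ p.length, ∀ j ∈ J, M (p.getVert s) j ≠ 0 →
      M (p.getVert t) j ≠ 0 → s ≤ t + 1 := fun s hs t ht j hj h1 h2 => by
    by_cases h : p.getVert s = p.getVert t
    · have := (hdist s hs).1
      rw [h, (hdist t ht).1] at this
      omega
    · have hadj : (M.rowGraph J).Adj (p.getVert t) (p.getVert s) := ⟨Ne.symm h, j, hj, h2, h1⟩
      have h3 := (hreach t).dist_triangle_left (p.getVert s)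
      rw [(hdist s hs).1, (hdist t ht).1, SimpleGraph.dist_eq_one_iff_adj.2 hadj] at h3
      exact h3
  -- A nonzero entry at an interior row would split the counterexample into two pairs at smaller
  -- distance.
  have hinner : ∀ t, 0 < t → t < p.length → M (p.getVert t) k = 0 := fun t h0 h1 => by
    by_contra hc
    have hd := hdist t h1.le
    exact hne ((hmin a (p.getVert t) (hreach t) (by omega) ha hc).trans
      (hmin (p.getVert t) b ⟨p.drop t⟩ (by omega) hc hb))
  have hstep : ∀ s : Fin p.length, ∃ j ∈ J, M (p.getVert s) j ≠ 0 ∧ M (p.getVert (s + 1)) j ≠ 0 :=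
    fun s => (p.adj_getVert_succ s.2).2
  choose j hjJ hj1 hj2 using hstep
  let B : Matrix (Fin (p.length + 1)) (Fin p.length) ℤ := of fun t s => M (p.getVert t) (j s)
  obtain ⟨x, y, hx, hy, hxy⟩ := exists_det_eq_of_cyclic hl B
    (fun t s h => by
      have h1 := hclose t (by omega) s (by omega) (j s) (hjJ s) h (hj1 s)
      have h2 := hclose (s + 1) (by omega) t (by omega) (j s) (hjJ s) (hj2 s) h
      have : t.val = s ∨ t.val = s + 1 := by omega
      exact this.imp (fun h => Fin.ext (by simpa using h)) (fun h => Fin.ext (by simpa using h)))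
    (fun s => ⟨hM.isUnit_of_ne_zero (by simpa using hj1 s),
      hM.isUnit_of_ne_zero (by simpa using hj2 s)⟩)
  have hval : ∀ t : Fin (p.length + 1), t ≠ 0 → t ≠ Fin.last _ → M (p.getVert t) k = 0 :=
    fun t h0 h1 => hinner t (Nat.pos_of_ne_zero fun h => h0 (Fin.ext h))
      (lt_of_le_of_ne (by omega) fun h => h1 (Fin.ext h))
  have hdet1 := hM.det_submatrix_cases (fun t : Fin (p.length + 1) => p.getVert t)
    (Fin.cons k j : Fin (p.length + 1) → n)
  have hdet2 := hM'.det_submatrix_cases (fun t : Fin (p.length + 1) => p.getVert t)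
    (Fin.cons k j : Fin (p.length + 1) → n)
  have e1 : M.submatrix (fun t : Fin (p.length + 1) => p.getVert t)
      (Fin.cons k j : Fin (p.length + 1) → n) =
      of fun t : Fin (p.length + 1) => Fin.cons (M (p.getVert t) k) (B t) := by
    ext t s
    refine Fin.cases ?_ (fun s => ?_) s <;> simp [B]
  have e2 : M'.submatrix (fun t : Fin (p.length + 1) => p.getVert t)
      (Fin.cons k j : Fin (p.length + 1) → n) =
      of fun t : Fin (p.length + 1) => Fin.cons (M' (p.getVert t) k) (B t) := by
    ext t s
    refine Fin.cases ?_ (fun s => ?_) s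
    · simp
    · simp [B, hJ _ _ (hjJ s)]
  rw [e1, hxy _ hval] at hdet1
  rw [e2, hxy _ fun t h0 h1 => (hk _).1 (hval t h0 h1)] at hdet2
  simp only [Fin.val_zero, Fin.val_last, SimpleGraph.Walk.getVert_zero,
    SimpleGraph.Walk.getVert_length] at hdet1 hdet2
  have ha' := hM'.entry_cases a k
  have hb' := hM'.entry_cases b k
  have ha0 := (hk a).not.1 ha
  have hb0 := (hk b).not.1 hb
  -- Each determinant is a sum of two units, hence even, hence zero by total unimodularity. The
  -- units `x` and `y` are common to both matrices, so the ratios at `a` and `b` coincide, contrary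
  -- to the choice of `a` and `b`.
  rw [Int.isUnit_iff] at hx hy
  rcases (hM.entry_cases a k).resolve_left ha with h1 | h1 <;>
    rcases (hM.entry_cases b k).resolve_left hb with h2 | h2 <;>
    rcases ha'.resolve_left ha0 with h3 | h3 <;> rcases hb'.resolve_left hb0 with h4 | h4 <;>
    rw [h1, h2, h3, h4] at hne <;> rw [h1, h2] at hdet1 <;> rw [h3, h4] at hdet2 <;> omega

/-- Camion's theorem: totally unimodular matrices of the same support agree up to changes of sign
of rows and columns. -/
theorem IsTotallyUnimodular.exists_signs_of_support_eq [Fintype n] (hM : M.IsTotallyUnimodular)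
    (hM' : M'.IsTotallyUnimodular) (h : ∀ i j, M i j = 0 ↔ M' i j = 0) :
    ∃ (r : m → ℤˣ) (c : n → ℤˣ), ∀ i j, M' i j = r i * c j * M i j := by
  classical
  suffices H : ∀ J : Finset n, ∃ (r : m → ℤˣ) (c : n → ℤˣ), ∀ i, ∀ j ∈ J,
      M' i j = r i * c j * M i j by
    obtain ⟨r, c, hrc⟩ := H Finset.univ
    exact ⟨r, c, fun i j => hrc i j (Finset.mem_univ _)⟩
  intro J
  induction J using Finset.induction_on with
  | empty => exact ⟨1, 1, by simp⟩
  | insert k J hkJ ih =>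
    obtain ⟨r, c, hrc⟩ := ih
    let M₀ : Matrix m n ℤ := of fun i j => (r i : ℤ) * (c j * M i j)
    have hM₀ : M₀.IsTotallyUnimodular := ((hM.scale_cols c).transpose.scale_cols r).transpose
    have hsupp : ∀ i j, M₀ i j = 0 ↔ M' i j = 0 := fun i j => by
      rw [← h i j]
      simp [M₀]
    have hJ : ∀ i, ∀ j ∈ (J : Set n), M₀ i j = M' i j := fun i j hj => by
      rw [hrc i j hj]
      simp only [M₀, of_apply]
      ring
    have key := fun a b hab ha hb => hM₀.ratio_eq_of_reachable hM' hJ (fun i => hsupp i k)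
      (a := a) (b := b) hab ha hb
    -- the sign of a row is the ratio at the column `k` in its component
    have hs : ∀ C : (M₀.rowGraph J).ConnectedComponent, ∃ u : ℤˣ, ∀ i,
        (M₀.rowGraph J).connectedComponentMk i = C → M' i k = u * M₀ i k := fun C => by
      by_cases hC : ∃ a, (M₀.rowGraph J).connectedComponentMk a = C ∧ M₀ a k ≠ 0
      · obtain ⟨a, rfl, ha⟩ := hC
        have h1 := hM₀.mul_self_entry ha
        have h2 := hM'.mul_self_entry ((hsupp a k).not.1 ha)
        have h3 : M' a k * M₀ a k * (M' a k * M₀ a k) = 1 := by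
          linear_combination (M' a k * M' a k) * h1 + h2
        refine ⟨⟨_, _, h3, h3⟩, fun i hi => ?_⟩
        by_cases h0 : M₀ i k = 0
        · rw [(hsupp i k).1 h0, h0, mul_zero]
        · have h4 := key i a (SimpleGraph.ConnectedComponent.eq.1 hi) h0 ha
          have h5 := hM₀.mul_self_entry h0
          change _ = M' a k * M₀ a k * M₀ i k
          linear_combination -M' i k * h5 + M₀ i k * h4
      · push Not at hC
        refine ⟨1, fun i hi => ?_⟩
        have := hC i hi
        rw [(hsupp i k).1 this, this, mul_zero]
    choose u hu using hs
    let ρ : m → ℤˣ := fun i => u ((M₀.rowGraph J).connectedComponentMk i)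
    -- The rows that meet a column of `J` are pairwise equal or adjacent, so they lie in one
    -- component and `ρ` is constant on them.
    have hcol : ∀ j ∈ J, ∃ v : ℤˣ, ∀ i, M₀ i j ≠ 0 → ρ i = v := fun j hj => by
      by_cases hex : ∃ a, M₀ a j ≠ 0
      · obtain ⟨a, ha⟩ := hex
        refine ⟨ρ a, fun i hi => ?_⟩
        have : (M₀.rowGraph J).Reachable i a := by
          by_cases hia : i = a
          · rw [hia]
          · exact SimpleGraph.Adj.reachable ⟨hia, j, hj, hi, ha⟩
        simp only [ρ]
        rw [SimpleGraph.ConnectedComponent.eq.2 this]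
      · push Not at hex
        exact ⟨1, fun i hi => absurd (hex i) hi⟩
    choose! v hv using hcol
    -- The row signs `ρ` repair column `k`; the column signs `v` undo their effect on `J`.
    refine ⟨fun i => ρ i * r i, fun j => if j = k then c k else v j * c j, fun i j hj => ?_⟩
    beta_reduce
    rcases Finset.mem_insert.1 hj with rfl | hj
    · rw [if_pos rfl, hu _ i rfl]
      simp only [M₀, of_apply, ρ]
      push_cast
      ring
    · rw [if_neg (fun h : j = k => hkJ (h ▸ hj)), ← hJ i j hj]
      by_cases h0 : M i j = 0
      · simp [M₀, h0]
      · rw [hv j hj i (by simpa [M₀] using h0)]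
        have hvv : (v j : ℤ) * v j = 1 := by
          rw [← Units.val_mul, Int.units_mul_self]; rfl
        simp only [M₀, of_apply]
        push_cast
        linear_combination -(r i * c j * M i j : ℤ) * hvv

end Matrix

/-! ## Isomorphisms of `q`-lattices and signed permutations of Gram matrices -/

/-- An integral matrix with orthonormal columns is a signed permutation matrix. -/
theorem Matrix.exists_signed_perm_of_transpose_mul_self {ι ι' : Type*} [Fintype ι] [Fintype ι']
    [DecidableEq ι] [DecidableEq ι'] (V : Matrix ι' ι ℤ) (hV : V.transpose * V = 1)
    (hcard : Fintype.card ι = Fintype.card ι') :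
    ∃ (τ : ι ≃ ι') (c : ι → ℤˣ), ∀ a j, V a j = if a = τ j then (c j : ℤ) else 0 := by
  have hcol : ∀ j, ∃ (t : ι') (u : ℤˣ), ∀ a, V a j = if a = t then (u : ℤ) else 0 := by
    intro j
    have h1 : ∑ a, V a j * V a j = 1 := by
      have := congrFun (congrFun hV j) j
      rwa [Matrix.mul_apply, Matrix.one_apply_eq] at this
    obtain ⟨t, -, ht⟩ : ∃ t ∈ Finset.univ, V t j * V t j ≠ 0 := by
      apply Finset.exists_ne_zero_of_sum_ne_zero
      rw [h1]
      exact one_ne_zero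
    rw [← Finset.add_sum_erase _ _ (Finset.mem_univ t)] at h1
    have h2 : 0 ≤ ∑ a ∈ Finset.univ.erase t, V a j * V a j :=
      Finset.sum_nonneg fun _ _ => mul_self_nonneg _
    have h3 : 0 < V t j * V t j := lt_of_le_of_ne (mul_self_nonneg _) ht.symm
    have h4 : ∑ a ∈ Finset.univ.erase t, V a j * V a j = 0 := by omega
    have h5 : V t j * V t j = 1 := by omega
    refine ⟨t, ⟨V t j, V t j, h5, h5⟩, fun a => ?_⟩
    by_cases hat : a = t
    · rw [hat, if_pos rfl]
    · rw [if_neg hat]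
      have := (Finset.sum_eq_zero_iff_of_nonneg fun _ _ => mul_self_nonneg _).1 h4 a
        (Finset.mem_erase.2 ⟨hat, Finset.mem_univ _⟩)
      exact mul_self_eq_zero.1 this
  choose t u htu using hcol
  have hinj : Function.Injective t := fun j k hjk => by
    by_contra hne
    have h1 := congrFun (congrFun hV j) k
    rw [Matrix.mul_apply, Matrix.one_apply_ne hne] at h1
    simp [Matrix.transpose_apply, htu, hjk] at h1
  exact ⟨Equiv.ofBijective t ((Fintype.bijective_iff_injective_and_card t).2 ⟨hinj, hcard⟩), u, fun a j => htu j a⟩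

theorem evalOne_qbar (f : ZQ) :
    SignedBipartiteGraph.evalOne (qbar f) = SignedBipartiteGraph.evalOne f := by
  induction f using LaurentPolynomial.induction_on' with
  | add f g hf hg => rw [map_add, map_add, map_add, hf, hg]
  | C_mul_T n a => rw [qbar_C_mul_T]; simp [SignedBipartiteGraph.evalOne]

section OfBasis

open LaurentPolynomial

variable {ι ι' M M' : Type*} [Fintype ι] [Fintype ι'] [DecidableEq ι] [DecidableEq ι']
  [AddCommGroup M] [Module ZQ M] [AddCommGroup M'] [Module ZQ M']

/-- Forms with Gram matrices `1 + q^k N` and `1 + q^k N'`, where `k ≠ 0`, are isometric only if `N`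
and `N'` are conjugate by a signed permutation. -/
theorem exists_signed_perm_of_form_eq (b : Module.Basis ι ZQ M) (b' : Module.Basis ι' ZQ M')
    (F : M →ₛₗ[qbar] M →ₗ[ZQ] ZQ) (F' : M' →ₛₗ[qbar] M' →ₗ[ZQ] ZQ) {N : Matrix ι ι ℤ}
    {N' : Matrix ι' ι' ℤ} {k : ℤ} (hk : k ≠ 0) (hN : N.IsSymm) (hN' : N'.IsSymm)
    (hF : ∀ i j, F (b i) (b j) = (1 : Matrix ι ι ZQ) i j + C (N i j) * T k)
    (hF' : ∀ i j, F' (b' i) (b' j) = (1 : Matrix ι' ι' ZQ) i j + C (N' i j) * T k)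
    (φ : M ≃ₗ[ZQ] M') (hφ : ∀ x y, F' (φ x) (φ y) = F x y) :
    ∃ (τ : ι ≃ ι') (c : ι → ℤˣ), ∀ i j, N' (τ i) (τ j) = c i * c j * N i j := by
  let U : Matrix ι' ι ZQ := Matrix.of fun a i => b'.repr (φ (b i)) a
  let P : Matrix ι ι ZQ := Matrix.of fun i j => ∑ a, qbar (U a i) * U a j
  let Q : Matrix ι ι ZQ := Matrix.of fun i j =>
    ∑ a, ∑ a', qbar (U a i) * U a' j * C (N' a a')
  have h1 : ∀ i j, (1 : Matrix ι ι ZQ) i j + C (N i j) * T k = P i j + Q i j * T k := by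
    intro i j
    rw [← hF, ← hφ, form_eq_sum b']
    have e : ∀ a a', qbar (b'.repr (φ (b i)) a) * b'.repr (φ (b j)) a' * F' (b' a) (b' a') =
        qbar (U a i) * U a' j * (1 : Matrix ι' ι' ZQ) a a' +
          qbar (U a i) * U a' j * C (N' a a') * T k := fun a a' => by
      rw [hF', mul_add, mul_assoc _ (C _)]
      rfl
    rw [Finset.sum_congr rfl fun a _ => Finset.sum_congr rfl fun a' _ => e a a']
    simp only [Finset.sum_add_distrib, ← Finset.sum_mul]
    congr 1
    refine Finset.sum_congr rfl fun a _ => ?_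
    rw [Finset.sum_eq_single a (fun a' _ h => by rw [Matrix.one_apply_ne h.symm, mul_zero])
      (fun h => absurd (Finset.mem_univ _) h), Matrix.one_apply_eq, mul_one]
  have hC : ∀ z : ℤ, qbar (C z) = C z := fun z => by
    simp [qbar]
  have hT : qbar (T k) = T (-k) := by simpa using qbar_C_mul_T 1 k
  have hP : ∀ i j, qbar (P j i) = P i j := fun i j => by
    simp only [P, Matrix.of_apply, map_sum, map_mul, qbar_qbar]
    exact Finset.sum_congr rfl fun _ _ => mul_comm _ _
  have hQ : ∀ i j, qbar (Q j i) = Q i j := fun i j => by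
    simp only [Q, Matrix.of_apply, map_sum, map_mul, qbar_qbar, hC]
    rw [Finset.sum_comm]
    refine Finset.sum_congr rfl fun a _ => Finset.sum_congr rfl fun a' _ => ?_
    rw [hN'.apply a a']
    ring
  -- With `P = U*U` and `Q = U*N'U` both Hermitian, the conjugate transpose of `h1` differs from it
  -- only in the power of `q`. As `qᵏ ≠ q⁻ᵏ`, the two equations give `Q = N` and `P = 1`.
  have h2 : ∀ i j, (1 : Matrix ι ι ZQ) i j + C (N i j) * T (-k) = P i j + Q i j * T (-k) := by
    intro i j
    have := congrArg qbar (h1 j i)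
    rw [map_add, map_add, map_mul, map_mul, hP, hQ, hC, hT, hN.apply i j] at this
    rw [← this]
    congr 1
    by_cases h : i = j <;> simp [h, Matrix.one_apply, eq_comm]
  have hTT : (T k - T (-k) : ZQ) ≠ 0 := fun h => by
    have := congrArg (fun f : ZQ => f.coeff k) (sub_eq_zero.1 h)
    simp [T_apply] at this
    omega
  have h3 : ∀ i j, Q i j = C (N i j) := fun i j => by
    have : (T k - T (-k) : ZQ) * (Q i j - C (N i j)) = 0 := by
      linear_combination h2 i j - h1 i j
    exact sub_eq_zero.1 ((mul_eq_zero.1 this).resolve_left hTT)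
  have h4 : ∀ i j, P i j = (1 : Matrix ι ι ZQ) i j := fun i j => by
    have := h1 i j
    rw [h3] at this
    exact (add_right_cancel this).symm
  let V : Matrix ι' ι ℤ := U.map SignedBipartiteGraph.evalOne
  have hevC : ∀ z : ℤ, SignedBipartiteGraph.evalOne (C z) = z := fun z => by
    simp [SignedBipartiteGraph.evalOne]
  have hVV : V.transpose * V = 1 := by
    ext i j
    have := congrArg SignedBipartiteGraph.evalOne (h4 i j)
    simp only [P, Matrix.of_apply, map_sum, map_mul, evalOne_qbar] at this
    rw [Matrix.mul_apply]
    refine this.trans ?_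
    by_cases h : i = j <;> simp [h, Matrix.one_apply]
  have hVN : ∀ i j, ∑ a, ∑ a', V a i * V a' j * N' a a' = N i j := fun i j => by
    have := congrArg SignedBipartiteGraph.evalOne (h3 i j)
    simp only [Q, Matrix.of_apply, map_sum, map_mul, evalOne_qbar, hevC] at this
    exact this
  obtain ⟨τ, c, hτ⟩ := V.exists_signed_perm_of_transpose_mul_self hVV
    (Fintype.card_congr ((b.map φ).indexEquiv b'))
  refine ⟨τ, c, fun i j => ?_⟩
  have hcc : ∀ j, (c j : ℤ) * c j = 1 := fun j => by
    rw [← Units.val_mul, Int.units_mul_self]; rfl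
  have h5 := hVN i j
  simp only [hτ, ite_mul, zero_mul, mul_ite, mul_zero, Finset.sum_ite_eq',
    Finset.mem_univ, if_true] at h5
  rw [← h5]
  linear_combination -(N' (τ i) (τ j)) * ((c j * c j : ℤ) * hcc i + hcc j)

theorem QLattice.StronglyIsomorphic.isomorphic {L L' : QLattice} (h : L.StronglyIsomorphic L') :
    L.Isomorphic L' :=
  h.imp fun _ hφ => hφ.1

/-- The isomorphism sends `b i` to `c i • b' (τ i)`. It commutes with the involutions because
integer scalars are fixed by the bar involution. -/
theorem QLattice.ofBasis_stronglyIsomorphic (b : Module.Basis ι ZQ M) (b' : Module.Basis ι' ZQ M')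
    {F : M →ₛₗ[qbar] M →ₗ[ZQ] ZQ} {F' : M' →ₛₗ[qbar] M' →ₗ[ZQ] ZQ}
    (hsymm : ∀ i j, F (b i) (b j) = F (b j) (b i))
    (hdet : (Matrix.of fun i j => F (b i) (b j)).det ≠ 0)
    (hsymm' : ∀ i j, F' (b' i) (b' j) = F' (b' j) (b' i))
    (hdet' : (Matrix.of fun i j => F' (b' i) (b' j)).det ≠ 0) (τ : ι ≃ ι') (c : ι → ℤˣ)
    (h : ∀ i j, F' (b' (τ i)) (b' (τ j)) = ((c i * c j : ℤ) : ZQ) * F (b i) (b j)) :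
    (QLattice.ofBasis b F hsymm hdet).StronglyIsomorphic
      (QLattice.ofBasis b' F' hsymm' hdet') := by
  let u : ι → ZQˣ := fun i => Units.map (Int.castRingHom ZQ).toMonoidHom (c i)
  let b'' : Module.Basis ι ZQ M' := (b'.reindex τ.symm).unitsSMul u
  have hb'' : ∀ i, b'' i = ((c i : ℤ) : ZQ) • b' (τ i) := fun i => by
    simp [b'', u, Module.Basis.unitsSMul_apply, Units.smul_def]
  let φ : M ≃ₗ[ZQ] M' := b.equiv b'' (Equiv.refl ι)
  have hφb : ∀ i, φ (b i) = ((c i : ℤ) : ZQ) • b' (τ i) := fun i => by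
    rw [← hb'']
    simp [φ]
  have hcc : ∀ j, ((c j : ℤ) : ZQ) * ((c j : ℤ) : ZQ) = 1 := fun j => by
    rw [← Int.cast_mul, ← Units.val_mul, Int.units_mul_self]; simp
  refine ⟨φ, fun (x y : M) => ?_, fun (x : M) => ?_⟩
  · change F' (φ x) (φ y) = F x y
    have hrepr : ∀ z i, b''.repr (φ z) i = b.repr z i := fun z i => by
      simp [φ, Module.Basis.equiv]
    rw [form_eq_sum b F, form_eq_sum b'' F']
    refine Finset.sum_congr rfl fun i _ => Finset.sum_congr rfl fun j _ => ?_
    rw [hrepr, hrepr, hb'', hb'', map_smul, LinearMap.map_smulₛₗ, LinearMap.smul_apply, h,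
      map_intCast, smul_eq_mul, smul_eq_mul, Int.cast_mul]
    linear_combination (qbar (b.repr x i) * b.repr y j * F (b i) (b j)) *
      ((c j * c j : ZQ) * hcc i + hcc j)
  · change φ (antilinearFixing b x) = antilinearFixing b' (φ x)
    conv_rhs => rw [← b.sum_repr x]
    simp only [map_sum, map_smul, LinearMap.map_smulₛₗ, hφb, antilinearFixing_basis, map_intCast]
    simp only [antilinearFixing, LinearMap.coe_mk, AddHom.coe_mk, map_sum, map_smul, hφb]

end OfBasis

/-! ### Gram matrices of the `q`-flow and `q`-cut lattices -/

namespace SignedBipartiteGraph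

open LaurentPolynomial

variable {E₀ E₁ E₀' E₁' : Type*} [Fintype E₀] [Fintype E₁] [DecidableEq E₀] [DecidableEq E₁]
  [Fintype E₀'] [Fintype E₁'] [DecidableEq E₀'] [DecidableEq E₁']

theorem form_basisFlow_eq (B : SignedBipartiteGraph E₀ E₁) (i j : E₁) :
    B.eulerForm (B.basisFlow i) (B.basisFlow j) =
      (1 : Matrix E₁ E₁ ZQ) i j + C ((B.adj.transpose * B.adj) i j) * T 2 := by
  have hT : (T 2 : ZQ) = T 1 * T 1 := by rw [← T_add]; rfl
  rw [form_basisFlow, Matrix.add_apply, Matrix.mul_apply, Matrix.mul_apply, map_sum,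
    Finset.sum_mul, hT]
  congr 1
  refine Finset.sum_congr rfl fun k _ => ?_
  simp only [qAdj, Matrix.transpose_apply, Matrix.of_apply, map_mul]
  ring

/-- The exponent is negative because the coordinates of `[L_i]` enter through the antilinear
argument, so the Gram matrix of the simples is the bar of an inverse block of `gramP`. -/
theorem form_basisCut_eq (B : SignedBipartiteGraph E₀ E₁) (i j : E₀) :
    B.eulerForm (B.basisCut i) (B.basisCut j) =
      (1 : Matrix E₀ E₀ ZQ) i j + C ((B.adj * B.adj.transpose) i j) * T (-2) := by
  have hT : (T 2 : ZQ) = T 1 * T 1 := by rw [← T_add]; rfl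
  have h : (1 + B.qAdj * B.qAdj.transpose : Matrix E₀ E₀ ZQ) i j =
      (1 : Matrix E₀ E₀ ZQ) i j + C ((B.adj * B.adj.transpose) i j) * T 2 := by
    rw [Matrix.add_apply, Matrix.mul_apply, Matrix.mul_apply, map_sum, Finset.sum_mul, hT]
    congr 1
    refine Finset.sum_congr rfl fun k _ => ?_
    simp only [qAdj, Matrix.transpose_apply, Matrix.of_apply, map_mul]
    ring
  rw [form_basisCut, h, map_add, qbar_C_mul_T]
  congr 1
  by_cases h : i = j <;> simp [h, Matrix.one_apply]

theorem exists_signed_perm_of_qFlow_isomorphic {B : SignedBipartiteGraph E₀ E₁}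
    {B' : SignedBipartiteGraph E₀' E₁'} (h : B.qFlow.Isomorphic B'.qFlow) :
    ∃ (τ : E₁ ≃ E₁') (c : E₁ → ℤˣ), ∀ i j, (B'.adj.transpose * B'.adj) (τ i) (τ j) =
      c i * c j * (B.adj.transpose * B.adj) i j := by
  obtain ⟨φ, hφ⟩ := h
  exact exists_signed_perm_of_form_eq B.basisFlow B'.basisFlow _ _ (k := 2) (by norm_num)
    (by simp [Matrix.IsSymm]) (by simp [Matrix.IsSymm])
    B.form_basisFlow_eq B'.form_basisFlow_eq φ hφ

theorem exists_signed_perm_of_qCut_isomorphic {B : SignedBipartiteGraph E₀ E₁}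
    {B' : SignedBipartiteGraph E₀' E₁'} (h : B.qCut.Isomorphic B'.qCut) :
    ∃ (τ : E₀ ≃ E₀') (c : E₀ → ℤˣ), ∀ i j, (B'.adj * B'.adj.transpose) (τ i) (τ j) =
      c i * c j * (B.adj * B.adj.transpose) i j := by
  obtain ⟨φ, hφ⟩ := h
  exact exists_signed_perm_of_form_eq B.basisCut B'.basisCut _ _ (k := -2) (by norm_num)
    (by simp [Matrix.IsSymm]) (by simp [Matrix.IsSymm])
    B.form_basisCut_eq B'.form_basisCut_eq φ hφ

variable {B : SignedBipartiteGraph E₀ E₁} {B' : SignedBipartiteGraph E₀' E₁'} {σ : E₀ ≃ E₀'}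
  {τ : E₁ ≃ E₁'} {r : E₀ → ℤˣ} {c : E₁ → ℤˣ}

theorem qFlow_stronglyIsomorphic_of_adj_eq
    (h : ∀ i j, B'.adj (σ i) (τ j) = r i * c j * B.adj i j) :
    B.qFlow.StronglyIsomorphic B'.qFlow := by
  refine QLattice.ofBasis_stronglyIsomorphic _ _ _ _ _ _ τ c fun i j => ?_
  have hrr : ∀ j, (r j : ℤ) * r j = 1 := fun j => by
    rw [← Units.val_mul, Int.units_mul_self]; rfl
  have hN : (B'.adj.transpose * B'.adj) (τ i) (τ j) =
      (c i * c j : ℤ) * (B.adj.transpose * B.adj) i j := by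
    simp only [Matrix.mul_apply, Matrix.transpose_apply]
    rw [← σ.sum_comp, Finset.mul_sum]
    refine Finset.sum_congr rfl fun k _ => ?_
    rw [h, h]
    linear_combination (c i * c j * B.adj k i * B.adj k j : ℤ) * hrr k
  rw [LinearMap.domRestrict₁₂_apply, LinearMap.domRestrict₁₂_apply, form_basisFlow_eq,
    form_basisFlow_eq, hN]
  by_cases hij : i = j
  · subst hij
    have hcc : (c i : ℤ) * c i = 1 := by rw [← Units.val_mul, Int.units_mul_self]; rfl
    simp [hcc]
  · rw [Matrix.one_apply_ne hij, Matrix.one_apply_ne (τ.injective.ne hij), map_mul]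
    simp [mul_assoc]

theorem qCut_stronglyIsomorphic_of_adj_eq
    (h : ∀ i j, B'.adj (σ i) (τ j) = r i * c j * B.adj i j) :
    B.qCut.StronglyIsomorphic B'.qCut := by
  refine QLattice.ofBasis_stronglyIsomorphic _ _ _ _ _ _ σ r fun i j => ?_
  have hcc : ∀ j, (c j : ℤ) * c j = 1 := fun j => by
    rw [← Units.val_mul, Int.units_mul_self]; rfl
  have hN : (B'.adj * B'.adj.transpose) (σ i) (σ j) =
      (r i * r j : ℤ) * (B.adj * B.adj.transpose) i j := by
    simp only [Matrix.mul_apply, Matrix.transpose_apply]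
    rw [← τ.sum_comp, Finset.mul_sum]
    refine Finset.sum_congr rfl fun k _ => ?_
    rw [h, h]
    linear_combination (r i * r j * B.adj i k * B.adj j k : ℤ) * hcc k
  rw [LinearMap.domRestrict₁₂_apply, LinearMap.domRestrict₁₂_apply, form_basisCut_eq,
    form_basisCut_eq, hN]
  by_cases hij : i = j
  · subst hij
    have hrr : (r i : ℤ) * r i = 1 := by rw [← Units.val_mul, Int.units_mul_self]; rfl
    simp [hrr]
  · rw [Matrix.one_apply_ne hij, Matrix.one_apply_ne (σ.injective.ne hij), map_mul]
    simp [mul_assoc]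

end SignedBipartiteGraph

/-! ## Integral flows on graphs -/

namespace Graph

open scoped Graph

variable {α β : Type*} {Γ : Graph α β}

open Classical in
/-- The boundary of an edge. -/
noncomputable def Orientation.incidence (ω : Γ.Orientation) (e : E(Γ)) : α → ℤ :=
  Pi.single (ω.tgt e) 1 - Pi.single (ω.src e) 1

/-- The lattice of integral flows. -/
noncomputable def Orientation.flows [Fintype E(Γ)] (ω : Γ.Orientation) :
    Submodule ℤ (E(Γ) → ℤ) :=
  LinearMap.ker (Fintype.linearCombination ℤ ω.incidence)

theorem Orientation.mem_flows [Fintype E(Γ)] {ω : Γ.Orientation} {x : E(Γ) → ℤ} :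
    x ∈ ω.flows ↔ ∑ e, x e • ω.incidence e = 0 := by
  rw [flows, LinearMap.mem_ker, Fintype.linearCombination_apply]

theorem Orientation.src_ne_tgt [Γ.Loopless] (ω : Γ.Orientation) (e : E(Γ)) :
    ω.src e ≠ ω.tgt e :=
  (ω.isLink e).ne

namespace OrientedCycle

open Classical in
/-- The direction in which a cycle runs through its edges. -/
noncomputable def dir (c : Γ.OrientedCycle) (ω : Γ.Orientation) (i : Fin (c.n + 1)) : ℤ :=
  if c.vert i = ω.src (c.edge i) then 1 else -1

theorem dir_cases (c : Γ.OrientedCycle) (ω : Γ.Orientation) (i : Fin (c.n + 1)) :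
    c.dir ω i = 1 ∨ c.dir ω i = -1 := by
  unfold dir
  split_ifs <;> simp

open Classical in
/-- The flow along a cycle. -/
noncomputable def flow (c : Γ.OrientedCycle) (ω : Γ.Orientation) : E(Γ) → ℤ :=
  ∑ i, Pi.single (c.edge i) (c.dir ω i)

theorem flow_edge (c : Γ.OrientedCycle) (ω : Γ.Orientation) (i : Fin (c.n + 1)) :
    c.flow ω (c.edge i) = c.dir ω i := by
  classical
  rw [flow, Finset.sum_apply, Finset.sum_eq_single i]
  · simp
  · intro k _ hk
    rw [Pi.single_apply, if_neg (fun h => hk (c.edge_injective h.symm))]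
  · simp

theorem flow_of_notMem {c : Γ.OrientedCycle} {ω : Γ.Orientation} {e : E(Γ)} (he : e ∉ c.edges) :
    c.flow ω e = 0 := by
  classical
  rw [flow, Finset.sum_apply]
  refine Finset.sum_eq_zero fun i _ => ?_
  rw [Pi.single_apply, if_neg (fun h => he ⟨i, h.symm⟩)]

theorem flow_ne_zero_iff {c : Γ.OrientedCycle} {ω : Γ.Orientation} {e : E(Γ)} :
    c.flow ω e ≠ 0 ↔ e ∈ c.edges := by
  refine ⟨fun h => by_contra fun he => h (flow_of_notMem he), ?_⟩
  rintro ⟨i, rfl⟩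
  rw [flow_edge]
  rcases c.dir_cases ω i with h | h <;> simp [h]

theorem flow_cases (c : Γ.OrientedCycle) (ω : Γ.Orientation) (e : E(Γ)) :
    c.flow ω e = 0 ∨ c.flow ω e = 1 ∨ c.flow ω e = -1 := by
  by_cases he : e ∈ c.edges
  · obtain ⟨i, rfl⟩ := he
    rw [flow_edge]
    exact Or.inr (c.dir_cases ω i)
  · exact Or.inl (flow_of_notMem he)

theorem flow_ne_zero (c : Γ.OrientedCycle) (ω : Γ.Orientation) : c.flow ω ≠ 0 := fun h =>
  flow_ne_zero_iff.2 (show c.edge 0 ∈ c.edges from ⟨0, rfl⟩) (congrFun h _)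

theorem support_flow (c : Γ.OrientedCycle) (ω : Γ.Orientation) :
    Function.support (c.flow ω) = c.edges :=
  Set.ext fun _ => flow_ne_zero_iff

open Classical in
theorem dir_smul_incidence (c : Γ.OrientedCycle) (ω : Γ.Orientation) (i : Fin (c.n + 1)) :
    c.dir ω i • ω.incidence (c.edge i) =
      Pi.single (c.vert (i + 1)) 1 - Pi.single (c.vert i) (1 : ℤ) := by
  unfold dir Orientation.incidence
  rcases (c.isLink i).eq_and_eq_or_eq_and_eq (ω.isLink (c.edge i)) with ⟨h1, h2⟩ | ⟨h1, h2⟩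
  · rw [if_pos h1, h1, h2, one_smul]
  -- The first case is a loop, whose boundary is zero.
  · split_ifs with h
    · rw [h2, ← h1, ← h, sub_self, smul_zero]
    · rw [h1, h2]
      simp

theorem sum_smul_incidence [Fintype E(Γ)] (c : Γ.OrientedCycle) (ω : Γ.Orientation)
    {x : E(Γ) → ℤ} (hx : ∀ e ∉ c.edges, x e = 0) :
    ∑ e, x e • ω.incidence e = ∑ i, x (c.edge i) • ω.incidence (c.edge i) := by
  classical
  rw [← Finset.sum_image (f := fun e => x e • ω.incidence e) (g := c.edge)
    (fun _ _ _ _ h => c.edge_injective h)]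
  refine (Finset.sum_subset (Finset.subset_univ _) fun e _ he => ?_).symm
  rw [hx e (by simpa [edges] using he), zero_smul]

theorem flow_mem_flows [Fintype E(Γ)] (c : Γ.OrientedCycle) (ω : Γ.Orientation) :
    c.flow ω ∈ ω.flows := by
  classical
  rw [Orientation.mem_flows, c.sum_smul_incidence ω fun e => flow_of_notMem]
  simp only [flow_edge, dir_smul_incidence, Finset.sum_sub_distrib]
  rw [sub_eq_zero]
  exact Equiv.sum_comp (Equiv.addRight (1 : Fin (c.n + 1)))
    (fun i => (Pi.single (c.vert i) 1 : α → ℤ))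

/-- A flow supported in a cycle is a multiple of the flow along the cycle. -/
theorem exists_smul_flow [Fintype E(Γ)] (c : Γ.OrientedCycle) {ω : Γ.Orientation}
    {x : E(Γ) → ℤ} (hx : x ∈ ω.flows) (hsupp : ∀ e ∉ c.edges, x e = 0) :
    ∃ a : ℤ, x = a • c.flow ω := by
  classical
  have hdd : ∀ i, c.dir ω i * c.dir ω i = 1 := fun i => by
    rcases c.dir_cases ω i with h | h <;> simp [h]
  let a : Fin (c.n + 1) → ℤ := fun i => c.dir ω i * x (c.edge i)
  have h1 : ∑ i, a i • (Pi.single (c.vert (i + 1)) 1 - Pi.single (c.vert i) 1 : α → ℤ) = 0 := by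
    rw [← Orientation.mem_flows.1 hx, c.sum_smul_incidence ω hsupp]
    refine Finset.sum_congr rfl fun i _ => ?_
    rw [← dir_smul_incidence, smul_smul]
    congr 1
    linear_combination x (c.edge i) * hdd i
  -- At the vertex `vert (k + 1)` only two edges of the cycle contribute to the boundary, one
  -- entering and one leaving.
  have hstep : ∀ k, a (k + 1) = a k := fun k => by
    have h2 := congrFun h1 (c.vert (k + 1))
    rw [Finset.sum_apply] at h2
    simp only [Pi.smul_apply, Pi.sub_apply, smul_eq_mul, mul_sub, Finset.sum_sub_distrib,
      Pi.single_apply, c.vert_injective.eq_iff, add_left_inj, mul_ite, mul_one, mul_zero,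
      Finset.sum_ite_eq, Finset.mem_univ, if_true, Pi.zero_apply] at h2
    omega
  have hconst : ∀ k, a k = a 0 := fun k => by
    induction k using Fin.induction with
    | zero => rfl
    | succ k ih => rw [← Fin.coeSucc_eq_succ, hstep, ih]
  refine ⟨a 0, funext fun e => ?_⟩
  by_cases he : e ∈ c.edges
  · obtain ⟨i, rfl⟩ := he
    rw [Pi.smul_apply, flow_edge, smul_eq_mul, ← hconst i]
    linear_combination -x (c.edge i) * hdd i
  · rw [hsupp e he, Pi.smul_apply, flow_of_notMem he, smul_zero]

theorem positive_iff [Γ.Loopless] {c : Γ.OrientedCycle} {ω : Γ.Orientation} {e : E(Γ)} :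
    c.Positive ω e ↔ c.flow ω e = 1 := by
  constructor
  · rintro ⟨i, rfl, h, -⟩
    rw [flow_edge, dir, if_pos h]
  · intro h
    obtain ⟨i, rfl⟩ : e ∈ c.edges := (flow_ne_zero_iff (ω := ω)).1 (by simp [h])
    rw [flow_edge, dir] at h
    have h1 : c.vert i = ω.src (c.edge i) := by
      by_contra h1
      rw [if_neg h1] at h
      omega
    exact ⟨i, rfl, h1, (h1 ▸ c.isLink i).right_unique (ω.isLink _)⟩

theorem negative_iff [Γ.Loopless] {c : Γ.OrientedCycle} {ω : Γ.Orientation} {e : E(Γ)} :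
    c.Negative ω e ↔ c.flow ω e = -1 := by
  constructor
  · rintro ⟨i, rfl, h, -⟩
    rw [flow_edge, dir, if_neg]
    rw [h]
    exact (ω.src_ne_tgt _).symm
  · intro h
    obtain ⟨i, rfl⟩ : e ∈ c.edges := (flow_ne_zero_iff (ω := ω)).1 (by simp [h])
    rw [flow_edge, dir] at h
    have h1 : c.vert i ≠ ω.src (c.edge i) := fun h1 => by
      rw [if_pos h1] at h
      omega
    rcases (c.isLink i).eq_and_eq_or_eq_and_eq (ω.isLink (c.edge i)) with h2 | h2
    · exact absurd h2.1 h1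
    · exact ⟨i, rfl, h2⟩

end OrientedCycle

/-! ### Cycles as minimal supports of flows -/

section Flows

variable [Fintype E(Γ)]

open Classical in
/-- A walk along edges in `S` yields a chain supported in `S`. -/
theorem Orientation.exists_chain (ω : Γ.Orientation) {R : α → α → Prop} {S : Set E(Γ)}
    (hR : ∀ u v, R u v → ∃ e ∈ S, Γ.IsLink e.1 u v) {u v : α} (huv : Relation.ReflTransGen R u v) :
    ∃ y : E(Γ) → ℤ, (∀ e ∉ S, y e = 0) ∧
      ∑ e, y e • ω.incidence e = (Pi.single v 1 - Pi.single u 1 : α → ℤ) := by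
  induction huv with
  | refl => exact ⟨0, by simp⟩
  | @tail w v _ hwv ih =>
    obtain ⟨y, hy, hy'⟩ := ih
    obtain ⟨e, he, hl⟩ := hR _ _ hwv
    have hs : ∃ s : ℤ, s • ω.incidence e = (Pi.single v 1 - Pi.single w 1 : α → ℤ) := by
      rcases hl.eq_and_eq_or_eq_and_eq (ω.isLink e) with ⟨rfl, rfl⟩ | ⟨rfl, rfl⟩
      · exact ⟨1, one_smul _ _⟩
      · exact ⟨-1, by simp [Orientation.incidence]⟩
    obtain ⟨s, hs⟩ := hs
    refine ⟨y + Pi.single e s, fun e' he' => ?_, ?_⟩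
    · rw [Pi.add_apply, hy e' he', Pi.single_eq_of_ne (fun h : e' = e => he' (h ▸ he)), add_zero]
    · simp only [Pi.add_apply, add_smul, Finset.sum_add_distrib, hy']
      rw [Finset.sum_eq_single e (fun e' _ h => by rw [Pi.single_eq_of_ne h, zero_smul])
        (fun h => absurd (Finset.mem_univ _) h), Pi.single_eq_same, hs]
      abel

/-- If the ends of `e` are joined by a walk along edges in `S`, where `e ∉ S`, then there is a flow
supported in `S ∪ {e}` that takes the value one at `e`. -/
theorem Orientation.exists_flow_of_walk (ω : Γ.Orientation) {R : α → α → Prop} {S : Set E(Γ)}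
    (hR : ∀ u v, R u v → ∃ e ∈ S, Γ.IsLink e.1 u v) {e : E(Γ)} (he : e ∉ S)
    (hwalk : Relation.ReflTransGen R (ω.tgt e) (ω.src e)) :
    ∃ x ∈ ω.flows, x e = 1 ∧ ∀ e' ∉ insert e S, x e' = 0 := by
  classical
  obtain ⟨y, hy, hy'⟩ := ω.exists_chain hR hwalk
  refine ⟨y + Pi.single e 1, ?_, by simp [hy e he], fun e' he' => ?_⟩
  · rw [mem_flows]
    simp only [Pi.add_apply, add_smul, Finset.sum_add_distrib, hy']
    rw [Finset.sum_eq_single e (fun e' _ h => by rw [Pi.single_eq_of_ne h, zero_smul])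
      (fun h => absurd (Finset.mem_univ _) h), Pi.single_eq_same, Orientation.incidence]
    simp
  · rw [Set.mem_insert_iff, not_or] at he'
    rw [Pi.add_apply, hy e' he'.2, Pi.single_eq_of_ne he'.1, add_zero]

variable [Γ.Loopless] {ω : Γ.Orientation}

/-- Every nonzero flow contains a cycle that runs through its edges in the direction of the flow. -/
theorem Orientation.exists_cycle_of_flow {x : E(Γ) → ℤ} (hx : x ∈ ω.flows) (hx0 : x ≠ 0) :
    ∃ c : Γ.OrientedCycle, ∀ e ∈ c.edges, 0 < x e * c.flow ω e := by
  classical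
  let tail : E(Γ) → α := fun e => if 0 < x e then ω.src e else ω.tgt e
  let head : E(Γ) → α := fun e => if 0 < x e then ω.tgt e else ω.src e
  have hlink : ∀ e : E(Γ), Γ.IsLink e (tail e) (head e) := fun e => by
    by_cases h : 0 < x e
    · simpa [tail, head, h] using ω.isLink e
    · simpa [tail, head, h] using (ω.isLink e).symm
  have hne : ∀ e, tail e ≠ head e := fun e => (hlink e).ne
  have hinc : ∀ e, x e • ω.incidence e =
      |x e| • (Pi.single (head e) 1 - Pi.single (tail e) 1 : α → ℤ) := fun e => by
    by_cases h : 0 < x e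
    · simp [tail, head, h, abs_of_pos h, Orientation.incidence]
    · rw [abs_of_nonpos (not_lt.1 h)]
      simp only [tail, head, if_neg h, Orientation.incidence]
      rw [neg_smul, ← smul_neg, neg_sub]
  -- With every edge directed along the flow, a head from which no edge of the support departs would
  -- have positive net inflow.
  have hnext : ∀ e : {e // x e ≠ 0}, ∃ e' : {e // x e ≠ 0}, tail e' = head e := by
    rintro ⟨e, he⟩
    by_contra! hc
    have h0 := congrFun (mem_flows.1 hx) (head e)
    simp only [hinc, Finset.sum_apply, Pi.smul_apply, Pi.sub_apply, smul_eq_mul,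
      Pi.zero_apply] at h0
    refine absurd h0 (ne_of_gt (Finset.sum_pos' (fun e' _ => ?_) ⟨e, Finset.mem_univ _, ?_⟩))
    · by_cases he' : x e' = 0
      · simp [he']
      · have := hc ⟨e', he'⟩
        rw [Pi.single_eq_of_ne (Ne.symm this), sub_zero]
        refine mul_nonneg (abs_nonneg _) ?_
        rw [Pi.single_apply]
        split_ifs <;> simp
    · rw [Pi.single_eq_same, Pi.single_eq_of_ne (hne e).symm, sub_zero, mul_one]
      exact abs_pos.2 he
  choose f hf using hnext
  obtain ⟨e₀, he₀⟩ : ∃ e, x e ≠ 0 := Function.ne_iff.1 hx0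
  let g : ℕ → {e // x e ≠ 0} := fun k => f^[k] ⟨e₀, he₀⟩
  have hg : ∀ k, tail (g (k + 1)) = head (g k) := fun k => by
    simp only [g, Function.iterate_succ_apply']
    exact hf _
  -- Following successors must repeat a vertex. A minimal gap `d + 1` makes the vertices in between
  -- distinct, and `d` is then the parameter `n` of a cycle of length `n + 1`.
  have hex : ∃ d a, tail (g a) = tail (g (a + (d + 1))) := by
    obtain ⟨a, b, hab, h⟩ := Finite.exists_ne_map_eq_of_infinite g
    rcases lt_or_gt_of_ne hab with hlt | hlt
    · exact ⟨b - a - 1, a, by rw [show a + (b - a - 1 + 1) = b by omega, h]⟩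
    · exact ⟨a - b - 1, b, by rw [show b + (a - b - 1 + 1) = a by omega, h]⟩
  obtain ⟨a, ha⟩ := Nat.find_spec hex
  have hmin : ∀ k l, k < l → l ≤ Nat.find hex → tail (g (a + k)) ≠ tail (g (a + l)) :=
    fun k l hkl hl h => Nat.find_min hex (m := l - k - 1) (by omega)
      ⟨a + k, by rw [show a + k + (l - k - 1 + 1) = a + l by omega, h]⟩
  have hinj : Function.Injective fun i : Fin (Nat.find hex + 1) => tail (g (a + i)) := by
    intro i k hik
    by_contra hne
    rcases lt_or_gt_of_ne (fun h => hne (Fin.ext h)) with h | h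
    · exact hmin i k h (by omega) hik
    · exact hmin k i h (by omega) hik.symm
  let c : Γ.OrientedCycle :=
    { n := Nat.find hex
      vert := fun i => tail (g (a + i))
      edge := fun i => g (a + i)
      vert_injective := hinj
      edge_injective := fun i k hik => hinj (congrArg tail hik)
      isLink := fun i => by
        have h : tail (g (a + (i + 1 : Fin (Nat.find hex + 1)))) = head (g (a + i)) := by
          rw [← hg]
          by_cases hi : i = Fin.last _
          · rw [hi, Fin.last_add_one, Fin.val_last]
            exact ha
          · rw [Fin.val_add_one_of_lt (Fin.lt_last_iff_ne_last.2 hi), add_assoc]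
        rw [h]
        exact hlink _ }
  refine ⟨c, ?_⟩
  rintro _ ⟨i, rfl⟩
  rw [OrientedCycle.flow_edge, OrientedCycle.dir]
  have hxi : x (c.edge i) ≠ 0 := (g (a + i)).2
  by_cases h : 0 < x (c.edge i)
  · have h1 : c.vert i = ω.src (c.edge i) := if_pos h
    rw [if_pos h1]
    omega
  · have h1 : c.vert i = ω.tgt (c.edge i) := if_neg h
    rw [h1, if_neg (ω.src_ne_tgt _).symm]
    omega

theorem Orientation.exists_cycle_subset_support {x : E(Γ) → ℤ} (hx : x ∈ ω.flows) (hx0 : x ≠ 0) :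
    ∃ c : Γ.OrientedCycle, c.edges ⊆ Function.support x := by
  obtain ⟨c, hc⟩ := Orientation.exists_cycle_of_flow hx hx0
  exact ⟨c, fun e he h0 => by simpa [h0] using hc e he⟩

/-- The cycles are the minimal supports of nonzero flows. -/
theorem isCycleEdgeSet_iff (ω : Γ.Orientation) {C : Set E(Γ)} : Γ.IsCycleEdgeSet C ↔
    (∃ x ∈ ω.flows, x ≠ 0 ∧ Function.support x = C) ∧
      ∀ y ∈ ω.flows, y ≠ 0 → Function.support y ⊆ C → Function.support y = C := by
  constructor
  · rintro ⟨c, rfl⟩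
    refine ⟨⟨c.flow ω, c.flow_mem_flows ω, c.flow_ne_zero ω, c.support_flow ω⟩,
      fun y hy hy0 hyc => ?_⟩
    obtain ⟨a, rfl⟩ := c.exists_smul_flow hy fun e he => by
      by_contra h
      exact he (hyc h)
    have ha : a ≠ 0 := fun ha => hy0 (by rw [ha, zero_smul])
    rw [← c.support_flow ω]
    ext e
    simp [ha]
  · rintro ⟨⟨x, hx, hx0, rfl⟩, hmin⟩
    obtain ⟨c, hc⟩ := Orientation.exists_cycle_subset_support hx hx0
    refine ⟨c, ?_⟩
    rw [← hmin _ (c.flow_mem_flows ω) (c.flow_ne_zero ω) (by rwa [c.support_flow]), c.support_flow]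

/-! ### Spanning trees, fundamental cycles and total unimodularity -/

namespace IsSpanningTree

variable {T : Set E(Γ)}

theorem flow_eq_zero (hT : Γ.IsSpanningTree T) {x : E(Γ) → ℤ} (hx : x ∈ ω.flows)
    (h : ∀ e ∉ T, x e = 0) : x = 0 := by
  by_contra hx0
  obtain ⟨c, hc⟩ := Orientation.exists_cycle_subset_support hx hx0
  exact hT.2 ⟨c, fun e he => by_contra fun heT => hc he (h e heT)⟩

/-- The edge `j`, closed up by a walk in the tree, gives a flow with value one at `j`. A cycle
directed along this flow must contain `j`, since `T` contains no cycle, and so runs through `j`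
positively. -/
theorem exists_fundCycle (hT : Γ.IsSpanningTree T) (ω : Γ.Orientation) {j : E(Γ)} (hj : j ∉ T) :
    ∃ c : Γ.OrientedCycle, c.edges ⊆ insert j T ∧ c.flow ω j = 1 := by
  obtain ⟨x, hx, hxj, hxT⟩ := ω.exists_flow_of_walk (R := (Γ.restrict (Subtype.val '' T)).Adj)
    (S := T) (fun u v ⟨e, he⟩ => by
      rw [restrict_isLink] at he
      obtain ⟨⟨e', he', rfl⟩, hl⟩ := he
      exact ⟨e', he', hl⟩) hj (hT.1.2 _ (ω.isLink j).right_mem _ (ω.isLink j).left_mem)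
  obtain ⟨c, hc⟩ := Orientation.exists_cycle_of_flow hx (fun h => by simp [h] at hxj)
  have hsub : c.edges ⊆ insert j T := fun e he => by
    by_contra h
    simpa [hxT e h] using hc e he
  have hjc : j ∈ c.edges := by
    by_contra h
    exact hT.2 ⟨c, fun e he => (hsub he).resolve_left fun h' => h (h' ▸ he)⟩
  refine ⟨c, hsub, ?_⟩
  have := hc j hjc
  rw [hxj, one_mul] at this
  rcases c.flow_cases ω j with h | h | h <;> omega

/-- Uniqueness of the fundamental cycle: the difference of the two sides is a flow supported in the
tree. -/
theorem flow_eq_smul (hT : Γ.IsSpanningTree T) {j : E(Γ)} {c c' : Γ.OrientedCycle}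
    (hc : c.edges ⊆ insert j T) (hc' : c'.edges ⊆ insert j T) (h : c.flow ω j = 1) :
    c'.flow ω = c'.flow ω j • c.flow ω := by
  rw [← sub_eq_zero]
  refine hT.flow_eq_zero (ω.flows.sub_mem (c'.flow_mem_flows ω)
    (ω.flows.smul_mem _ (c.flow_mem_flows ω))) fun e he => ?_
  rw [Pi.sub_apply, Pi.smul_apply]
  by_cases hej : e = j
  · rw [hej, h]; simp
  · rw [OrientedCycle.flow_of_notMem fun h => (hc h).elim hej he,
      OrientedCycle.flow_of_notMem fun h => (hc' h).elim hej he]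
    simp

theorem adj_eq (hT : Γ.IsSpanningTree T) {j : (Tᶜ : Set E(Γ))} {c : Γ.OrientedCycle}
    (hc : c.edges ⊆ insert j.1 T) (h : c.flow ω j = 1) (i : T) :
    (Γ.bipartite ω T).adj i j = c.flow ω i := by
  have huniq : ∀ c' : Γ.OrientedCycle, c'.edges ⊆ insert j.1 T → c'.Positive ω j →
      c'.flow ω = c.flow ω := fun c' hc' hp => by
    rw [hT.flow_eq_smul hc hc' h, OrientedCycle.positive_iff.1 hp, one_smul]
  have hp := OrientedCycle.positive_iff.2 h
  change (((Γ.bipartite ω T).sign i j : SignType) : ℤ) = _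
  simp only [bipartite]
  split_ifs with h1 h2
  · obtain ⟨c', hc', hp', hi⟩ := h1
    rw [← huniq c' hc' hp', OrientedCycle.positive_iff.1 hi]
    rfl
  · obtain ⟨c', hc', hp', hi⟩ := h2
    rw [← huniq c' hc' hp', OrientedCycle.negative_iff.1 hi]
    rfl
  · rcases c.flow_cases ω i with h3 | h3 | h3
    · rw [h3]; rfl
    · exact absurd ⟨c, hc, hp, OrientedCycle.positive_iff.2 h3⟩ h1
    · exact absurd ⟨c, hc, hp, OrientedCycle.negative_iff.2 h3⟩ h2

/-- No direction of `c` is prescribed, so this applies to the image of a fundamental cycle under a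
cycle-preserving bijection, which is only known as a set of edges. -/
theorem adj_ne_zero_iff (hT : Γ.IsSpanningTree T) (ω : Γ.Orientation) {j : (Tᶜ : Set E(Γ))}
    {c : Γ.OrientedCycle} (hc : c.edges ⊆ insert j.1 T) (i : T) :
    (Γ.bipartite ω T).adj i j ≠ 0 ↔ i.1 ∈ c.edges := by
  obtain ⟨d, hd, hdj⟩ := hT.exists_fundCycle ω j.2
  have h := hT.flow_eq_smul hd hc hdj
  have h0 : c.flow ω j ≠ 0 := fun h0 => c.flow_ne_zero ω (by rw [h, h0, zero_smul])
  rw [hT.adj_eq hd hdj, ← OrientedCycle.flow_ne_zero_iff (ω := ω), h, Pi.smul_apply, smul_eq_mul,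
    mul_ne_zero_iff]
  exact ⟨fun h => ⟨h0, h⟩, fun h => h.2⟩

open Classical in
/-- A flow is determined by its values outside a spanning tree. -/
theorem mem_flows_iff (hT : Γ.IsSpanningTree T) (ω : Γ.Orientation) {x : E(Γ) → ℤ} :
    x ∈ ω.flows ↔ ∀ i : T, x i = ∑ j : (Tᶜ : Set E(Γ)), (Γ.bipartite ω T).adj i j * x j := by
  choose c hc hcj using fun j : (Tᶜ : Set E(Γ)) => hT.exists_fundCycle ω j.2
  let x' : E(Γ) → ℤ := ∑ j : (Tᶜ : Set E(Γ)), x j • (c j).flow ω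
  have hx' : x' ∈ ω.flows :=
    ω.flows.sum_mem fun j _ => ω.flows.smul_mem _ ((c j).flow_mem_flows ω)
  have hT' : ∀ i : T, x' i = ∑ j : (Tᶜ : Set E(Γ)), (Γ.bipartite ω T).adj i j * x j := fun i => by
    simp only [x', Finset.sum_apply, Pi.smul_apply, smul_eq_mul]
    refine Finset.sum_congr rfl fun j _ => ?_
    rw [hT.adj_eq (hc j) (hcj j), mul_comm]
  have hN : ∀ k ∉ T, x' k = x k := fun k hk => by
    simp only [x', Finset.sum_apply, Pi.smul_apply, smul_eq_mul]
    rw [Finset.sum_eq_single ⟨k, hk⟩]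
    · rw [hcj ⟨k, hk⟩, mul_one]
    · intro j _ hjk
      rw [OrientedCycle.flow_of_notMem fun h =>
        (hc j h).elim (fun h => hjk (Subtype.ext h.symm)) hk, mul_zero]
    · simp
  constructor
  · intro hx i
    have := hT.flow_eq_zero (ω.flows.sub_mem hx hx') fun e he => by
      rw [Pi.sub_apply, hN e he, sub_self]
    rw [← hT', sub_eq_zero.1 this]
  · intro h
    have : x = x' := funext fun e => by
      by_cases he : e ∈ T
      · rw [h ⟨e, he⟩, ← hT' ⟨e, he⟩]
      · exact (hN e he).symm
    rwa [this]

open Classical in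
theorem exists_flow_extending (hT : Γ.IsSpanningTree T) (ω : Γ.Orientation)
    (z : (Tᶜ : Set E(Γ)) → ℤ) : ∃ x ∈ ω.flows, (∀ j : (Tᶜ : Set E(Γ)), x j = z j) ∧
      ∀ i : T, x i = ((Γ.bipartite ω T).adj.mulVec z) i := by
  let x : E(Γ) → ℤ := fun e => if h : e ∈ T then ((Γ.bipartite ω T).adj.mulVec z) ⟨e, h⟩
    else z ⟨e, h⟩
  have h1 : ∀ j : (Tᶜ : Set E(Γ)), x j = z j := fun j => dif_neg j.2
  have h2 : ∀ i : T, x i = ((Γ.bipartite ω T).adj.mulVec z) i := fun i => dif_pos i.2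
  refine ⟨x, (hT.mem_flows_iff ω).2 fun i => ?_, h1, h2⟩
  rw [h2]
  simp only [h1]
  rfl

/-- Flows along cycles have entries `0` and `±1`. For a square submatrix `B` with nonzero
determinant they provide an integral `Y` such that `B * Y` is diagonal with entries `±1`, so `det B`
is a unit. -/
theorem isTotallyUnimodular_adj (hT : Γ.IsSpanningTree T) (ω : Γ.Orientation) :
    (Γ.bipartite ω T).adj.IsTotallyUnimodular := by
  classical
  intro k f g hf hg
  let B := (Γ.bipartite ω T).adj.submatrix f g
  change B.det ∈ _
  by_cases hdet : B.det = 0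
  · exact ⟨0, by simp [hdet]⟩
  -- the flow through `f a` and some of the edges `g b` contains a cycle
  have hex : ∀ a : Fin k, ∃ (y : Fin k → ℤ) (s : ℤ), IsUnit s ∧
      B.mulVec y = Pi.single a s := by
    intro a
    -- A column of the adjugate gives a flow that, among the tree edges `f a'`, is nonzero only at
    -- `f a`. Any cycle in its support inherits this vanishing.
    let z : (Tᶜ : Set E(Γ)) → ℤ := ∑ b, Pi.single (g b) (B.adjugate b a)
    have hzg : ∀ b, z (g b) = B.adjugate b a := fun b => by
      simp only [z, Finset.sum_apply, Pi.single_apply, hg.eq_iff]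
      simp
    have hz0 : ∀ j ∉ Set.range g, z j = 0 := fun j hj => by
      simp only [z, Finset.sum_apply]
      exact Finset.sum_eq_zero fun b _ => Pi.single_eq_of_ne (fun h => hj ⟨b, h.symm⟩) _
    have hmul : ∀ w : (Tᶜ : Set E(Γ)) → ℤ, (∀ j ∉ Set.range g, w j = 0) →
        ∀ a', ((Γ.bipartite ω T).adj.mulVec w) (f a') = (B.mulVec (w ∘ g)) a' := by
      intro w hw a'
      simp only [Matrix.mulVec, dotProduct]
      refine Eq.trans ?_ (Finset.sum_image (s := Finset.univ) (g := g)
        (f := fun j => (Γ.bipartite ω T).adj (f a') j * w j) fun _ _ _ _ h => hg h)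
      refine (Finset.sum_subset (Finset.subset_univ _) fun j _ hj => ?_).symm
      rw [hw j (by simpa using hj), mul_zero]
    obtain ⟨x, hx, hxN, hxT⟩ := hT.exists_flow_extending ω z
    have hBz : B.mulVec (z ∘ g) = Pi.single a B.det := by
      ext a'
      have h2 := congrFun (congrFun B.mul_adjugate a') a
      rw [Matrix.mul_apply] at h2
      simp only [Matrix.mulVec, dotProduct, Function.comp, hzg, h2, Matrix.smul_apply,
        Matrix.one_apply, Pi.single_apply]
      simp
    have hxf : ∀ a', x (f a') = (Pi.single a B.det : Fin k → ℤ) a' := fun a' => by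
      rw [hxT, hmul z hz0, hBz]
    obtain ⟨c, hc⟩ := Orientation.exists_cycle_subset_support hx fun h => by
      have := hxf a
      rw [h, Pi.single_eq_same] at this
      exact hdet this.symm
    have hcx : ∀ e, x e = 0 → c.flow ω e = 0 := fun e he =>
      OrientedCycle.flow_of_notMem fun h => hc h he
    let w : (Tᶜ : Set E(Γ)) → ℤ := fun j => c.flow ω j
    have hw : ∀ j ∉ Set.range g, w j = 0 := fun j hj => hcx j (by rw [hxN, hz0 j hj])
    have hBw : B.mulVec (w ∘ g) = Pi.single a (c.flow ω (f a)) := by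
      ext a'
      have h1 := (hT.mem_flows_iff ω).1 (c.flow_mem_flows ω) (f a')
      rw [← hmul w hw]
      refine h1.symm.trans ?_
      by_cases h : a' = a
      · rw [h, Pi.single_eq_same]
      · rw [Pi.single_eq_of_ne h]
        exact hcx _ (by rw [hxf, Pi.single_eq_of_ne h])
    refine ⟨w ∘ g, _, ?_, hBw⟩
    -- Otherwise invertibility of `B` over the rationals makes the cycle avoid all edges outside
    -- `T`.
    have hne : c.flow ω (f a) ≠ 0 := fun h0 => by
      rw [h0, Pi.single_zero] at hBw
      have h1 := Matrix.eq_zero_of_mulVec_eq_zero hdet hBw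
      refine c.flow_ne_zero ω (hT.flow_eq_zero (c.flow_mem_flows ω) fun e he => ?_)
      by_cases hr : (⟨e, he⟩ : (Tᶜ : Set E(Γ))) ∈ Set.range g
      · obtain ⟨b, hb⟩ := hr
        have h2 := congrFun h1 b
        simp only [Function.comp, w, hb] at h2
        exact h2
      · exact hw _ hr
    rw [Int.isUnit_iff]
    exact (c.flow_cases ω _).resolve_left hne
  choose y s hs hy using hex
  have hBY : B * Matrix.of (fun b a => y a b) = Matrix.diagonal s := by
    ext a' a
    have := congrFun (hy a) a'
    rw [Matrix.mul_apply]
    refine this.trans ?_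
    by_cases h : a' = a
    · rw [h, Pi.single_eq_same, Matrix.diagonal_apply_eq]
    · rw [Pi.single_eq_of_ne h, Matrix.diagonal_apply_ne _ h]
  have hunit : IsUnit B.det := by
    refine isUnit_of_mul_isUnit_left (y := (Matrix.of fun b a => y a b).det) ?_
    rw [← Matrix.det_mul, hBY, Matrix.det_diagonal, IsUnit.prod_univ_iff]
    exact hs
  rcases Int.isUnit_iff.1 hunit with h | h
  · exact ⟨1, by simp [h]⟩
  · exact ⟨-1, by simp [h]⟩

/-- In a 2-edge-connected graph every edge of a spanning tree lies in a fundamental cycle. -/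
theorem exists_adj_ne_zero_of_mem (hT : Γ.IsSpanningTree T) (hΓ : Γ.IsTwoEdgeConnected)
    (ω : Γ.Orientation) (i : T) : ∃ j, (Γ.bipartite ω T).adj i j ≠ 0 := by
  classical
  by_contra! h
  -- Since the ends of `i` stay joined without `i`, some flow takes the value one at `i`; a zero row
  -- would force it to vanish there.
  obtain ⟨x, hx, hxi, -⟩ := ω.exists_flow_of_walk (R := (Γ.deleteEdges {i.1.1}).Adj)
    (S := {i.1}ᶜ) (fun u v ⟨e, he⟩ => by
      rw [deleteEdges_isLink] at he
      exact ⟨⟨e, he.1.edge_mem⟩, fun h => he.2 (congrArg Subtype.val h), he.1⟩)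
    (e := i.1) (fun h => h rfl)
    ((hΓ.2 _ i.1.2).2 _ (ω.isLink i).right_mem _ (ω.isLink i).left_mem)
  have := (hT.mem_flows_iff ω).1 hx i
  simp [h, hxi] at this

/-- In a loopless graph every fundamental cycle meets the spanning tree. -/
theorem exists_adj_ne_zero_of_notMem (hT : Γ.IsSpanningTree T) (ω : Γ.Orientation)
    (j : (Tᶜ : Set E(Γ))) : ∃ i, (Γ.bipartite ω T).adj i j ≠ 0 := by
  classical
  by_contra! h
  -- A zero column makes the single edge `j` a flow, which is possible only for a loop.
  have hx : (Pi.single j.1 1 : E(Γ) → ℤ) ∈ ω.flows := by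
    rw [hT.mem_flows_iff]
    intro i
    rw [Pi.single_eq_of_ne (fun hij : i.1 = j.1 => j.2 (hij ▸ i.2))]
    refine (Finset.sum_eq_zero fun k _ => ?_).symm
    by_cases hk : k = j
    · rw [hk, h, zero_mul]
    · rw [Pi.single_eq_of_ne (fun h => hk (Subtype.ext h)), mul_zero]
  rw [Orientation.mem_flows, Finset.sum_eq_single j.1
    (fun e _ h => by rw [Pi.single_eq_of_ne h, zero_smul])
    (fun h => absurd (Finset.mem_univ _) h)] at hx
  have h1 := congrFun hx (ω.tgt j)
  simp [Orientation.incidence, Pi.single_eq_of_ne (ω.src_ne_tgt j.1).symm] at h1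

end IsSpanningTree

/-! ## Cycle-preserving bijections and fundamental cycles -/

variable {α' β' : Type*} {Γ' : Graph α' β'} [Fintype E(Γ')] [Γ'.Loopless] {ω' : Γ'.Orientation}

/-- Cycles are the minimal supports of nonzero flows, and sign changes do not affect supports. -/
theorem cyclePreserving_of_flows {F : E(Γ) ≃ E(Γ')} (s : E(Γ) → ℤˣ)
    (h : ∀ x : E(Γ) → ℤ, x ∈ ω.flows ↔ (fun e => s (F.symm e) * x (F.symm e)) ∈ ω'.flows) :
    CyclePreserving F := by
  intro C
  let G : (E(Γ) → ℤ) → E(Γ') → ℤ := fun x e => s (F.symm e) * x (F.symm e)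
  have hss : ∀ e, (s e : ℤ) * s e = 1 := fun e => by
    rw [← Units.val_mul, Int.units_mul_self]; rfl
  have hsurj : ∀ y, ∃ x, G x = y := fun y => by
    refine ⟨fun e => s e * y (F e), funext fun e => ?_⟩
    simp only [G, Equiv.apply_symm_apply]
    linear_combination y e * hss (F.symm e)
  have hsupp : ∀ x, Function.support (G x) = F '' Function.support x := fun x => by
    ext e
    simp [G, Equiv.image_eq_preimage_symm]
  have h0 : ∀ x, G x ≠ 0 ↔ x ≠ 0 := fun x => by
    rw [← Function.support_nonempty_iff, ← Function.support_nonempty_iff, hsupp, Set.image_nonempty]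
  rw [isCycleEdgeSet_iff ω, isCycleEdgeSet_iff ω']
  refine and_congr ⟨?_, ?_⟩ ⟨fun H y hy hy0 hyC => ?_, fun H y hy hy0 hyC => ?_⟩
  · rintro ⟨y, hy, hy0, hyC⟩
    obtain ⟨x, rfl⟩ := hsurj y
    refine ⟨x, (h x).2 hy, (h0 x).1 hy0, ?_⟩
    rw [hsupp] at hyC
    exact F.injective.image_injective hyC
  · rintro ⟨x, hx, hx0, rfl⟩
    exact ⟨G x, (h x).1 hx, (h0 x).2 hx0, hsupp x⟩
  · have := H (G y) ((h y).1 hy) ((h0 y).2 hy0) (by rw [hsupp]; exact Set.image_mono hyC)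
    rw [hsupp] at this
    exact F.injective.image_injective this
  · obtain ⟨x, rfl⟩ := hsurj y
    rw [hsupp] at hyC ⊢
    rw [H x ((h x).2 hy) ((h0 x).1 hy0) ((Set.image_subset_image_iff F.injective).1 hyC)]

variable {T : Set E(Γ)} {T' : Set E(Γ')}

/-- Signed permutations that identify the signed bipartite graphs yield a cycle-preserving
bijection. -/
theorem exists_cyclePreserving_of_adj_eq (hT : Γ.IsSpanningTree T) (hT' : Γ'.IsSpanningTree T')
    (σ : T ≃ T') (τ : (Tᶜ : Set E(Γ)) ≃ (T'ᶜ : Set E(Γ'))) (r : T → ℤˣ)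
    (c : (Tᶜ : Set E(Γ)) → ℤˣ) (h : ∀ i j, (Γ'.bipartite ω' T').adj (σ i) (τ j) =
      r i * c j * (Γ.bipartite ω T).adj i j) :
    ∃ F : E(Γ) ≃ E(Γ'), CyclePreserving F ∧ F '' T = T' := by
  classical
  let F : E(Γ) ≃ E(Γ') := (Equiv.Set.sumCompl T).symm.trans
    ((Equiv.sumCongr σ τ).trans (Equiv.Set.sumCompl T'))
  have hFT : ∀ i : T, F i = σ i := fun i => by
    simp [F, Equiv.Set.sumCompl_symm_apply]
  have hFN : ∀ j : (Tᶜ : Set E(Γ)), F j = τ j := fun j => by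
    simp [F, Equiv.Set.sumCompl_symm_apply_compl]
  let s : E(Γ) → ℤˣ := fun e => if he : e ∈ T then r ⟨e, he⟩ else c ⟨e, he⟩
  have hsT : ∀ i : T, s i = r i := fun i => dif_pos i.2
  have hsN : ∀ j : (Tᶜ : Set E(Γ)), s j = c j := fun j => dif_neg j.2
  have hrr : ∀ i, (r i : ℤ) * r i = 1 := fun e => by
    rw [← Units.val_mul, Int.units_mul_self]; rfl
  have hcc : ∀ j, (c j : ℤ) * c j = 1 := fun e => by
    rw [← Units.val_mul, Int.units_mul_self]; rfl
  refine ⟨F, cyclePreserving_of_flows (ω := ω) (ω' := ω') s fun x => ?_, ?_⟩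
  -- In the equation for a tree edge the column signs cancel against those of `x`, and the row sign
  -- is a common factor.
  · rw [hT.mem_flows_iff, hT'.mem_flows_iff, ← σ.forall_congr_right]
    refine forall_congr' fun i => ?_
    rw [← hFT, Equiv.symm_apply_apply, hsT, ← τ.sum_comp]
    simp only [← hFN, Equiv.symm_apply_apply, hsN, h]
    have : ∑ j, (r i * c j * (Γ.bipartite ω T).adj i j : ℤ) * (c j * x j) =
        r i * ∑ j : (Tᶜ : Set E(Γ)), (Γ.bipartite ω T).adj i j * x j := by
      rw [Finset.mul_sum]
      refine Finset.sum_congr rfl fun j _ => ?_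
      linear_combination (r i * (Γ.bipartite ω T).adj i j * x j : ℤ) * hcc j
    rw [this]
    exact ((r i).isUnit.mul_right_inj).symm
  · ext e
    constructor
    · rintro ⟨i, hi, rfl⟩
      rw [hFT ⟨i, hi⟩]
      exact (σ _).2
    · intro he
      refine ⟨σ.symm ⟨e, he⟩, (σ.symm _).2, ?_⟩
      rw [hFT, Equiv.apply_symm_apply]

/-- A cycle-preserving bijection that preserves the spanning trees identifies the signed bipartite
graphs up to changes of sign of rows and columns. -/
theorem CyclePreserving.exists_adj_eq (hT : Γ.IsSpanningTree T) (hT' : Γ'.IsSpanningTree T')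
    (ω : Γ.Orientation) (ω' : Γ'.Orientation) {F : E(Γ) ≃ E(Γ')} (hF : CyclePreserving F)
    (hFT : F '' T = T') :
    ∃ (σ : T ≃ T') (τ : (Tᶜ : Set E(Γ)) ≃ (T'ᶜ : Set E(Γ'))) (r : T → ℤˣ)
      (c : (Tᶜ : Set E(Γ)) → ℤˣ), ∀ i j, (Γ'.bipartite ω' T').adj (σ i) (τ j) =
        r i * c j * (Γ.bipartite ω T).adj i j := by
  classical
  have hmem : ∀ e, e ∈ T ↔ F e ∈ T' := fun e => by
    rw [← hFT, F.injective.mem_set_image]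
  let σ : T ≃ T' := F.subtypeEquiv hmem
  let τ : (Tᶜ : Set E(Γ)) ≃ (T'ᶜ : Set E(Γ')) := F.subtypeEquiv fun e => (hmem e).not
  have hsupp : ∀ i j, (Γ.bipartite ω T).adj i j ≠ 0 ↔
      (Γ'.bipartite ω' T').adj (σ i) (τ j) ≠ 0 := fun i j => by
    obtain ⟨c, hc, -⟩ := hT.exists_fundCycle ω j.2
    obtain ⟨c', hc'⟩ := (hF c.edges).2 ⟨c, rfl⟩
    rw [hT.adj_ne_zero_iff ω hc, hT'.adj_ne_zero_iff ω' (c := c'), hc']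
    · exact (F.injective.mem_set_image).symm
    · rw [hc']
      rintro _ ⟨e, he, rfl⟩
      exact (hc he).imp (fun h => congrArg F h) (hmem e).1
  -- The bijection of undirected cycles determines only the supports; Camion's theorem supplies the
  -- signs.
  obtain ⟨r, c, hrc⟩ := (hT.isTotallyUnimodular_adj ω).exists_signs_of_support_eq
    ((hT'.isTotallyUnimodular_adj ω').submatrix σ τ) fun i j => not_iff_not.1 (hsupp i j)
  exact ⟨σ, τ, r, c, hrc⟩

end Flows

end Graph

/-! ### The Torelli theorem for `q`-flow and `q`-cut lattices -/

section BipartiteTorelli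

open scoped Graph

variable {α α' β β' : Type*} {Γ : Graph α β} {Γ' : Graph α' β'} [Fintype E(Γ)] [Fintype E(Γ')]
  [Γ.Loopless] [Γ'.Loopless] {ω : Γ.Orientation} {ω' : Γ'.Orientation} {T : Set E(Γ)}
  {T' : Set E(Γ')}

open Classical in
theorem Graph.exists_cyclePreserving_of_qFlow_isomorphic (hΓ : Γ.IsTwoEdgeConnected)
    (hΓ' : Γ'.IsTwoEdgeConnected) (hT : Γ.IsSpanningTree T) (hT' : Γ'.IsSpanningTree T')
    (h : (Γ.bipartite ω T).qFlow.Isomorphic (Γ'.bipartite ω' T').qFlow) :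
    ∃ F : E(Γ) ≃ E(Γ'), Graph.CyclePreserving F ∧ F '' T = T' := by
  obtain ⟨τ, c, hτ⟩ := SignedBipartiteGraph.exists_signed_perm_of_qFlow_isomorphic h
  obtain ⟨σ, r, hσ⟩ := (hT.isTotallyUnimodular_adj ω).exists_equiv_of_gram_equiv
    (hT'.isTotallyUnimodular_adj ω') (hT.exists_adj_ne_zero_of_mem hΓ ω)
    (hT'.exists_adj_ne_zero_of_mem hΓ' ω') τ c hτ
  exact Graph.exists_cyclePreserving_of_adj_eq hT hT' σ τ r c hσ

open Classical in
theorem Graph.exists_cyclePreserving_of_qCut_isomorphic (hT : Γ.IsSpanningTree T)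
    (hT' : Γ'.IsSpanningTree T')
    (h : (Γ.bipartite ω T).qCut.Isomorphic (Γ'.bipartite ω' T').qCut) :
    ∃ F : E(Γ) ≃ E(Γ'), Graph.CyclePreserving F ∧ F '' T = T' := by
  obtain ⟨σ, r, hσ⟩ := SignedBipartiteGraph.exists_signed_perm_of_qCut_isomorphic h
  obtain ⟨τ, c, hτ⟩ := (hT.isTotallyUnimodular_adj ω).transpose.exists_equiv_of_gram_equiv
    (hT'.isTotallyUnimodular_adj ω').transpose (hT.exists_adj_ne_zero_of_notMem ω)
    (hT'.exists_adj_ne_zero_of_notMem ω') σ r hσ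
  refine Graph.exists_cyclePreserving_of_adj_eq (ω := ω) (ω' := ω') hT hT' σ τ r c
    fun i j => ?_
  rw [mul_comm (r i : ℤ)]
  exact hτ j i

end BipartiteTorelli

open scoped Graph in
theorem mainTheorem1 {α₁ β₁ α₂ β₂ : Type*}
    (Γ₁ : Graph α₁ β₁) (Γ₂ : Graph α₂ β₂) [Finite E(Γ₁)] [Finite E(Γ₂)]
    [Γ₁.Loopless] [Γ₂.Loopless]
    (hΓ₁ : Γ₁.IsTwoEdgeConnected) (hΓ₂ : Γ₂.IsTwoEdgeConnected)
    (ω₁ : Γ₁.Orientation) (ω₂ : Γ₂.Orientation)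
    (T₁ : Set E(Γ₁)) (T₂ : Set E(Γ₂))
    (hT₁ : Γ₁.IsSpanningTree T₁) (hT₂ : Γ₂.IsSpanningTree T₂) :
    List.TFAE [
      (Γ₁.qFlow ω₁ T₁).Isomorphic (Γ₂.qFlow ω₂ T₂),
      ∃ F : E(Γ₁) ≃ E(Γ₂), Graph.CyclePreserving F ∧ F '' T₁ = T₂,
      (Γ₁.qCut ω₁ T₁).Isomorphic (Γ₂.qCut ω₂ T₂)] ∧
    List.TFAE [
      (Γ₁.qFlow ω₁ T₁).StronglyIsomorphic (Γ₂.qFlow ω₂ T₂),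
      ∃ F : E(Γ₁) ≃ E(Γ₂), Graph.CyclePreserving F ∧ F '' T₁ = T₂,
      (Γ₁.qCut ω₁ T₁).StronglyIsomorphic (Γ₂.qCut ω₂ T₂)] := by

  classical
  -- These are the instances in the definitions of `Graph.qFlow` and `Graph.qCut`, which therefore
  -- unfold to the lattices of the bipartite graphs.
  let _ : Fintype E(Γ₁) := Fintype.ofFinite _
  let _ : Fintype E(Γ₂) := Fintype.ofFinite _
  have h12 : (Γ₁.qFlow ω₁ T₁).Isomorphic (Γ₂.qFlow ω₂ T₂) →
      ∃ F : E(Γ₁) ≃ E(Γ₂), Graph.CyclePreserving F ∧ F '' T₁ = T₂ := fun h =>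
    Graph.exists_cyclePreserving_of_qFlow_isomorphic (ω := ω₁) (ω' := ω₂) hΓ₁ hΓ₂ hT₁ hT₂ h
  have h32 : (Γ₁.qCut ω₁ T₁).Isomorphic (Γ₂.qCut ω₂ T₂) →
      ∃ F : E(Γ₁) ≃ E(Γ₂), Graph.CyclePreserving F ∧ F '' T₁ = T₂ := fun h =>
    Graph.exists_cyclePreserving_of_qCut_isomorphic (ω := ω₁) (ω' := ω₂) hT₁ hT₂ h
  -- The bijection yields the strong isomorphism while the weak one suffices for the converse, so
  -- both equivalences follow from the same four implications.
  have h21 : (∃ F : E(Γ₁) ≃ E(Γ₂), Graph.CyclePreserving F ∧ F '' T₁ = T₂) →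
      (Γ₁.qFlow ω₁ T₁).StronglyIsomorphic (Γ₂.qFlow ω₂ T₂) := by
    rintro ⟨F, hF, hFT⟩
    obtain ⟨σ, τ, r, c, h⟩ := hF.exists_adj_eq hT₁ hT₂ ω₁ ω₂ hFT
    exact SignedBipartiteGraph.qFlow_stronglyIsomorphic_of_adj_eq h
  have h23 : (∃ F : E(Γ₁) ≃ E(Γ₂), Graph.CyclePreserving F ∧ F '' T₁ = T₂) →
      (Γ₁.qCut ω₁ T₁).StronglyIsomorphic (Γ₂.qCut ω₂ T₂) := by
    rintro ⟨F, hF, hFT⟩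
    obtain ⟨σ, τ, r, c, h⟩ := hF.exists_adj_eq hT₁ hT₂ ω₁ ω₂ hFT
    exact SignedBipartiteGraph.qCut_stronglyIsomorphic_of_adj_eq h
  constructor
  · tfae_have 1 → 2 := h12
    tfae_have 2 → 1 := fun h => (h21 h).isomorphic
    tfae_have 3 → 2 := h32
    tfae_have 2 → 3 := fun h => (h23 h).isomorphic
    tfae_finish
  · tfae_have 1 → 2 := fun h => h12 h.isomorphic
    tfae_have 2 → 1 := h21
    tfae_have 3 → 2 := fun h => h32 h.isomorphic
    tfae_have 2 → 3 := h23
    tfae_finish
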